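/- Let $K=\mathbb{F}_q$ range over the finite fields of odd cardinality $q$. For $d\ge 0$ let $\mathcal{F}_d\subset \mathbb{F}_q[X]$ be the (finite, non-empty) set of monic square-free polynomials of degree $d$, with the uniform probability measure. For $F\in\mathcal{F}_d$ put $S(F)=\sum_{x\in\mathbb{F}_q}\chi(F(x))$, where $\chi$ is the quadratic character of $\mathbb{F}_q$ with $\chi(0)=0$, and for an integer $k\ge 0$ let $$M_k(q,d)=\frac{1}{|\mathcal{F}_d|}\sum_{F\in\mathcal{F}_d}\left(\frac{S(F)}{\sqrt q}\right)^k .$$ Let $X_1,\dots,X_q$ be independent random variables, each taking the value $0$ with probability $\frac{1}{q+1}$ and each of the values $1$ and $-1$ with probability $\frac{1}{2(1+q^{-1})}$. (a) There is an absolute constant $C$ such that for all odd prime powers $q$ and all integers $k,d\ge 0$, $$\left|M_k(q,d)-\mathbb{E}\left(\left(\frac{X_1+\dots+X_q}{\sqrt q}\right)^k\right)\right|\le C\,q^{(3k-d)/2}.$$ (b) If $q$ (through odd prime powers) and $d$ both tend to infinity, then for every integer $k\ge 0$ the moment $M_k(q,d)$ converges to the $k$-th moment $\frac{1}{\sqrt{2\pi}}\int_{\mathbb{R}}x^k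 e^{-x^2/2}\,dx$ of the standard Gaussian distribution, and the distribution of $S(F)/\sqrt q$, for $F$ drawn uniformly from $\mathcal{F}_d$, converges weakly to the standard Gaussian distribution. -/

import Mathlib

open Polynomial Filter Topology MeasureTheory ProbabilityTheory

noncomputable section

namespace CharSum

/-- The monic square-free polynomials of degree `d` over `K`. -/
def sqfreeSet (K : Type*) [Field K] (d : ℕ) : Set K[X] :=
  {F | F.Monic ∧ F.natDegree = d ∧ Squarefree F}

theorem sqfreeSet_finite (K : Type*) [Field K] [Finite K] (d : ℕ) : (sqfreeSet K d).Finite := by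
  have h : Set.Finite (Set.range fun c : Fin (d + 1) → K => ∑ i, C (c i) * X ^ (i : ℕ)) :=
    Set.finite_range _
  refine h.subset ?_
  rintro F ⟨-, hd, -⟩
  refine ⟨fun i => F.coeff i, ?_⟩
  have := F.as_sum_range_C_mul_X_pow
  rw [hd] at this
  conv_rhs => rw [this]
  exact Fin.sum_univ_eq_sum_range (fun i => C (F.coeff i) * X ^ i) (d + 1)

theorem sqfreeSet_nonempty (K : Type*) [Field K] (d : ℕ) : (sqfreeSet K d).Nonempty := by
  rcases Nat.lt_or_ge d 2 with h | h
  · interval_cases d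
    · exact ⟨1, monic_one, natDegree_one, squarefree_one⟩
    · exact ⟨X, monic_X, natDegree_X, irreducible_X.squarefree⟩
  by_cases hd : (d : K) = 0
  · have hlt : (X : K[X]).degree < d := by
      rw [degree_X]; exact_mod_cast h
    refine ⟨X ^ d - X, monic_X_pow_sub (by rw [degree_X]; exact_mod_cast h), ?_, ?_⟩
    · rw [natDegree_sub_eq_left_of_natDegree_lt] <;> simp; omega
    · refine Separable.squarefree ?_
      have : derivative (X ^ d - X : K[X]) = -1 := by
        simp [derivative_X_pow, hd]
      rw [separable_def, this]
      exact isCoprime_one_right.neg_right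
  · refine ⟨X ^ d - C 1, monic_X_pow_sub_C 1 (by omega), natDegree_X_pow_sub_C, ?_⟩
    exact (separable_X_pow_sub_C 1 hd one_ne_zero).squarefree

/-- The finite family `𝓕_d` of monic square-free polynomials of degree `d` over a finite field. -/
def family (K : Type*) [Field K] [Fintype K] (d : ℕ) : Finset K[X] :=
  (sqfreeSet_finite K d).toFinset

theorem family_nonempty (K : Type*) [Field K] [Fintype K] (d : ℕ) : (family K d).Nonempty := by
  simpa [family] using sqfreeSet_nonempty K d

open Classical in
/-- `S(F) = ∑_{x ∈ K} χ(F(x))`, with `χ` the quadratic character of `K` and `χ(0) = 0`. -/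
def charSum {K : Type*} [Field K] [Fintype K] (F : K[X]) : ℤ :=
  ∑ x : K, quadraticChar K (F.eval x)

/-- `S(F) / √q`, where `q` is the number of elements of `K`. -/
def normSum {K : Type*} [Field K] [Fintype K] (F : K[X]) : ℝ :=
  (charSum F : ℝ) / √(Fintype.card K : ℝ)

/-- The `k`-th moment `M_k(q,d)` of `S(F) / √q` over the family `𝓕_d`. -/
def moment (K : Type*) [Field K] [Fintype K] (k d : ℕ) : ℝ :=
  (1 / ((family K d).card : ℝ)) * ∑ F ∈ family K d, normSum F ^ k

/-- The value distribution of `S(F) / √q`: its law when `F` is drawn uniformly from `𝓕_d`. -/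
def valueLaw (K : Type*) [Field K] [Fintype K] (d : ℕ) : ProbabilityMeasure ℝ :=
  ⟨((PMF.uniformOfFinset (family K d) (family_nonempty K d)).map normSum).toMeasure,
    inferInstance⟩

/-- The trinomial law: mass `1/(q+1)` at `0` and mass `1/(2(1+q⁻¹))` at each of `1` and `-1`. -/
def trinomialLaw (q : ℕ) : Measure ℝ :=
  ENNReal.ofReal (1 / ((q : ℝ) + 1)) • Measure.dirac 0
    + ENNReal.ofReal (1 / (2 * (1 + (q : ℝ)⁻¹))) • Measure.dirac 1
    + ENNReal.ofReal (1 / (2 * (1 + (q : ℝ)⁻¹))) • Measure.dirac (-1)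

/-- The standard Gaussian law on `ℝ`. -/
def stdGaussian : ProbabilityMeasure ℝ := ⟨gaussianReal 0 1, inferInstance⟩

end CharSum

end

/-!
Expanding `S(F) ^ k` over exponent vectors `e : K → ℕ` with `∑ e = k` reduces the moment comparison
to the mean over `𝓕_d` of the completely multiplicative weight `∏ₓ χ(F(x)) ^ e(x)`, to be compared
with the product of the moments of the trinomial law of orders `e(x)`. Let `s` be the support of
`e` and `m ≤ min(k, q)` its size.

* By interpolation the values on `s` of a monic polynomial of degree `n ≥ m` are independent and
  uniform, so the sum of the weight over these polynomials is exactly `c qⁿ`, with `c` a product of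
  local means (`monicSum_eq`); for `n < m` the bound `qⁿ` suffices.
* Every monic polynomial is `A² B` with `A` monic and `B` monic square-free in exactly one way, and
  the weight of `A²` is the indicator that `A` has no zero in `s`. The monic polynomials without a
  zero in `s` have generating series `(1 - u) ^ m / (1 - q u)`. Hence the generating series of the
  sums over `𝓕_d` is `(1 - q u²) / (1 - u²) ^ m` times that of the sums over all monic polynomials
  (`sqfreeSum_eq`).
* The coefficient of `uⁱ` in the first factor is at most `q ^ (i / 2)`. Extracting the main term
  `c q ^ d (1 - q⁻¹) / (1 - q⁻²) ^ m` leaves an error `O(q ^ (d / 2 + m))`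
  (`abs_convolution_sub_le`), and dividing by `|𝓕_d| = q ^ d (1 - q⁻¹)` turns the local means into
  trinomial moments (`abs_sqfreeSum_div_sub_le`). The multinomial coefficients add up to `q ^ k`,
  which gives the bound (`abs_moment_sub_le`).

For the limit, the trinomial moments are coefficients of `φ ^ q`, where `φ` is the exponential
generating series of the trinomial law. The identity `(φ ^ (n + 1))' = (n + 1) φ ^ n φ'` becomes, as
`q → ∞`, the recursion `g (k + 2) = (k + 1) g k` of the Gaussian moments
(`tendsto_coeff_trinomialSeries_pow`). Weak convergence follows by the method of moments
(`tendsto_of_tendsto_moments`): the characteristic functions are compared through their Taylor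
polynomials, whose coefficients converge and whose remainders are controlled by even moments, and
Lévy's continuity theorem applies.
-/

namespace CharSum

section

open Finset

/-! ### Squares times square-free polynomials -/

section Decomposition

variable {K : Type*} [Field K]

/-- Dividing `A` and `A'` by their gcd leaves coprime parts, and the square of the part of `A`
then divides the square-free `B`, so it is a unit. -/
theorem dvd_of_sq_dvd_sq_mul {A A' B : K[X]} (hA : A ≠ 0) (hB : Squarefree B)
    (h : A ^ 2 ∣ A' ^ 2 * B) : A ∣ A' := by
  classical
  obtain ⟨g, α, α', hcop, rfl, rfl⟩ :
      ∃ g α α' : K[X], IsCoprime α α' ∧ A = g * α ∧ A' = g * α' := by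
    obtain ⟨α, hα⟩ := EuclideanDomain.gcd_dvd_left A A'
    obtain ⟨α', hα'⟩ := EuclideanDomain.gcd_dvd_right A A'
    have hg : EuclideanDomain.gcd A A' ≠ 0 := fun h0 => hA (by rw [hα, h0, zero_mul])
    refine ⟨EuclideanDomain.gcd A A', α, α', ?_, hα, hα'⟩
    have hb := EuclideanDomain.gcd_eq_gcd_ab A A'
    refine ⟨EuclideanDomain.gcdA A A', EuclideanDomain.gcdB A A', ?_⟩
    apply mul_left_cancel₀ hg
    calc EuclideanDomain.gcd A A' * (EuclideanDomain.gcdA A A' * α + EuclideanDomain.gcdB A A' * α')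
        = EuclideanDomain.gcd A A' * α * EuclideanDomain.gcdA A A'
          + EuclideanDomain.gcd A A' * α' * EuclideanDomain.gcdB A A' := by ring
      _ = A * EuclideanDomain.gcdA A A' + A' * EuclideanDomain.gcdB A A' := by rw [← hα, ← hα']
      _ = EuclideanDomain.gcd A A' * 1 := by rw [mul_one, hb.symm]
  have hg : g ≠ 0 := left_ne_zero_of_mul hA
  have h1 : α ^ 2 ∣ α' ^ 2 * B := by
    rw [mul_pow, mul_pow, mul_assoc] at h
    exact (mul_dvd_mul_iff_left (pow_ne_zero 2 hg)).1 h
  have h2 : α * α ∣ B := by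
    rw [← sq]
    exact (IsCoprime.pow hcop).dvd_of_dvd_mul_left h1
  exact mul_dvd_mul_left g ((hB α h2).dvd)

/-- Uniqueness of the decomposition of a monic polynomial as a square times a square-free part. -/
theorem eq_of_sq_mul_eq_sq_mul {A A' B B' : K[X]} (hA : A.Monic) (hA' : A'.Monic)
    (hB : Squarefree B) (hB' : Squarefree B') (h : A ^ 2 * B = A' ^ 2 * B') :
    A = A' ∧ B = B' := by
  have e : A = A' := eq_of_monic_of_associated hA hA' (associated_of_dvd_dvd
    (dvd_of_sq_dvd_sq_mul hA.ne_zero hB' (h ▸ dvd_mul_right _ _))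
    (dvd_of_sq_dvd_sq_mul hA'.ne_zero hB (h ▸ dvd_mul_right _ _)))
  subst e
  exact ⟨rfl, mul_left_cancel₀ (pow_ne_zero 2 hA.ne_zero) h⟩

/-- Existence of the decomposition of a monic polynomial as a square times a square-free part. -/
theorem exists_sq_mul_squarefree (n : ℕ) : ∀ F : K[X], F.Monic → F.natDegree = n →
    ∃ A B : K[X], A.Monic ∧ B.Monic ∧ Squarefree B ∧ A ^ 2 * B = F := by
  induction n using Nat.strong_induction_on with
  | _ n ih =>
    intro F hF hn
    by_cases hs : Squarefree F
    · exact ⟨1, F, monic_one, hF, hs, by simp⟩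
    · simp only [Squarefree, not_forall] at hs
      obtain ⟨x, ⟨G, hG⟩, hx⟩ := hs
      have hx0 : x ≠ 0 := by
        rintro rfl
        exact hF.ne_zero (by simpa using hG)
      -- normalise the repeated factor to be monic
      set y : K[X] := x * C x.leadingCoeff⁻¹ with hy
      have hym : y.Monic := monic_mul_leadingCoeff_inv hx0
      have hxy : x = y * C x.leadingCoeff := by
        rw [hy, mul_assoc, ← C_mul, inv_mul_cancel₀ (leadingCoeff_ne_zero.2 hx0), C_1, mul_one]
      obtain ⟨H, hH⟩ : y ^ 2 ∣ F :=
        ⟨C x.leadingCoeff ^ 2 * G, by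
          rw [hG]; conv_lhs => rw [hxy]
          ring⟩
      have hHm : H.Monic := (hym.pow 2).of_mul_monic_left (hH ▸ hF)
      have hyd : 0 < y.natDegree := by
        rcases Nat.eq_zero_or_pos y.natDegree with h0 | h0
        · exfalso
          apply hx
          rw [hxy, eq_one_of_monic_natDegree_zero hym h0, one_mul, isUnit_C]
          exact (leadingCoeff_ne_zero.2 hx0).isUnit
        · exact h0
      have hdeg : n = 2 * y.natDegree + H.natDegree := by
        rw [← hn, hH, (hym.pow 2).natDegree_mul hHm, hym.natDegree_pow]
      obtain ⟨A, B, hA, hB, hBs, hAB⟩ := ih H.natDegree (by omega) H hHm rfl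
      exact ⟨y * A, B, hym.mul hA, hB, hBs, by rw [hH, ← hAB]; ring⟩

end Decomposition

/-! ### Monic polynomials and their values -/

section Monics

variable (K : Type*) [Field K] [Fintype K]

open Classical in
/-- The finite set of monic polynomials of degree `n` over a finite field. -/
noncomputable def monics (n : ℕ) : Finset K[X] :=
  univ.image fun c : Fin n → K => X ^ n + ((degreeLTEquiv K n).symm c : K[X])

variable {K}

theorem mem_monics {n : ℕ} {F : K[X]} : F ∈ monics K n ↔ F.Monic ∧ F.natDegree = n := by
  simp only [monics, mem_image, mem_univ, true_and]
  constructor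
  · rintro ⟨c, rfl⟩
    have h := mem_degreeLT.1 ((degreeLTEquiv K n).symm c).2
    exact ⟨monic_X_pow_add h, natDegree_eq_of_degree_eq_some
      (by rw [degree_add_eq_left_of_degree_lt] <;> simp [h])⟩
  · rintro ⟨hF, rfl⟩
    have h : F - X ^ F.natDegree ∈ degreeLT K F.natDegree := by
      rw [mem_degreeLT, ← degree_eq_natDegree hF.ne_zero]
      apply degree_sub_lt_left _ hF.ne_zero (by simp [hF])
      rw [degree_X_pow, degree_eq_natDegree hF.ne_zero]
    exact ⟨degreeLTEquiv K _ ⟨_, h⟩, by simp⟩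

theorem sum_monics {M : Type*} [AddCommMonoid M] (n : ℕ) (f : K[X] → M) :
    ∑ F ∈ monics K n, f F =
      ∑ c : Fin n → K, f (X ^ n + ((degreeLTEquiv K n).symm c : K[X])) := by
  classical
  rw [monics, sum_image]
  intro c _ c' _ h
  exact (degreeLTEquiv K n).symm.injective (Subtype.ext (add_left_cancel h))

theorem card_monics (n : ℕ) : (monics K n).card = Fintype.card K ^ n := by
  rw [card_eq_sum_ones, sum_monics]; simp

theorem mem_family {d : ℕ} {F : K[X]} :
    F ∈ family K d ↔ F.Monic ∧ F.natDegree = d ∧ Squarefree F := by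
  simp [family, sqfreeSet]

/-- Averaging over a finite group along a surjective homomorphism. -/
theorem sum_comp_surjective_mul_card {G H : Type*} [AddCommGroup G] [AddCommGroup H] [Fintype G]
    [Fintype H] (φ : G →+ H) (hφ : Function.Surjective φ) (g : H → ℝ) :
    (∑ a, g (φ a)) * Fintype.card H = Fintype.card G * ∑ b, g b := by
  classical
  have hfib : ∀ b, #{a | φ a = b} = #{a | φ a = 0} := fun b =>
    AddMonoidHom.card_fiber_eq_of_mem_range φ (hφ b) (hφ 0)
  have hG : Fintype.card G = Fintype.card H * #{a | φ a = 0} := by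
    rw [← card_univ, card_eq_sum_card_fiberwise (f := φ) (t := univ) (by simp)]
    simp [hfib]
  have hS : ∑ a, g (φ a) = #{a | φ a = 0} * ∑ b, g b := by
    rw [← sum_fiberwise univ φ, mul_sum]
    refine sum_congr rfl fun b _ => ?_
    rw [sum_congr rfl (g := fun _ => g b), sum_const, hfib, nsmul_eq_mul]
    intro a ha
    rw [(mem_filter.1 ha).2]
  rw [hS, hG]; push_cast; ring

open Classical in
/-- The values of a uniformly random monic polynomial of degree `n` at at most `n` points are
independent and uniformly distributed. -/
theorem sum_monics_eval_mul_card (s : Finset K) {n : ℕ} (hn : #s ≤ n) (g : (s → K) → ℝ) :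
    (∑ F ∈ monics K n, g fun x => F.eval (x : K)) * (Fintype.card K : ℝ) ^ #s
      = (Fintype.card K : ℝ) ^ n * ∑ v, g v := by
  classical
  let φ : (Fin n → K) →+ (s → K) :=
    { toFun := fun c x => ((degreeLTEquiv K n).symm c : K[X]).eval (x : K)
      map_zero' := by ext; simp
      map_add' := by intro a b; ext; simp }
  have hφ : Function.Surjective φ := by
    intro v
    let r : K → K := fun x => if h : x ∈ s then v ⟨x, h⟩ else 0
    have hinj : Set.InjOn (id : K → K) s := Function.injective_id.injOn
    have hlt : Lagrange.interpolate s id r ∈ degreeLT K n := by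
      rw [mem_degreeLT]
      exact (Lagrange.degree_interpolate_lt r hinj).trans_le (by exact_mod_cast hn)
    refine ⟨degreeLTEquiv K n ⟨_, hlt⟩, ?_⟩
    ext x
    have := Lagrange.eval_interpolate_at_node r hinj x.2
    simp only [id] at this
    have hr : r x = v x := by simp [r]
    simpa [φ] using this.trans hr
  have key := sum_comp_surjective_mul_card φ hφ fun v => g fun x => (x : K) ^ n + v x
  rw [sum_monics]
  simp only [eval_add, eval_pow, eval_X]
  have hshift : ∑ v : s → K, g (fun x => (x : K) ^ n + v x) = ∑ v, g v :=
    Equiv.sum_comp (Equiv.addLeft fun x : s => (x : K) ^ n) g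
  rw [hshift] at key
  simpa [φ] using key

end Monics

/-! ### Weighted sums over monic and square-free polynomials -/

section Weight

open Classical in
/-- The points that occur in the exponent vector `e`. -/
noncomputable def expSupport {K : Type*} [Fintype K] (e : K → ℕ) : Finset K := {x | e x ≠ 0}

theorem mem_expSupport {K : Type*} [Fintype K] {e : K → ℕ} {x : K} :
    x ∈ expSupport e ↔ e x ≠ 0 := by
  simp [expSupport]

variable {K : Type*} [Field K] [Fintype K]

open Classical in
/-- The completely multiplicative weight `∏ₓ χ(F(x)) ^ e(x)` attached to an exponent vector `e`,
where `χ` is the quadratic character. Points with `e(x) = 0` contribute `1`, also at the zeros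
of `F`. -/
noncomputable def weight (e : K → ℕ) (F : K[X]) : ℝ :=
  ∏ x, (quadraticChar K (F.eval x) : ℝ) ^ e x

theorem weight_mul (e : K → ℕ) (F G : K[X]) : weight e (F * G) = weight e F * weight e G := by
  simp only [weight, ← prod_mul_distrib, eval_mul, map_mul, Int.cast_mul, mul_pow]

open Classical in
theorem abs_quadraticChar_le_one (a : K) : |(quadraticChar K a : ℝ)| ≤ 1 := by
  rcases eq_or_ne a 0 with rfl | h
  · simp
  · rcases quadraticChar_dichotomy h with h | h <;> simp [h]

theorem abs_weight_le_one (e : K → ℕ) (F : K[X]) : |weight e F| ≤ 1 := by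
  classical
  rw [weight, abs_prod]
  refine prod_le_one (fun _ _ => abs_nonneg _) fun x _ => ?_
  rw [abs_pow]
  exact pow_le_one₀ (abs_nonneg _) (abs_quadraticChar_le_one _)

open Classical in
theorem weight_sq (e : K → ℕ) (F : K[X]) :
    weight e F ^ 2 = if ∀ x ∈ expSupport e, F.eval x ≠ 0 then 1 else 0 := by
  rw [weight, ← prod_pow]
  split_ifs with h
  · refine prod_eq_one fun x _ => ?_
    rcases eq_or_ne (e x) 0 with h0 | h0
    · simp [h0]
    · rcases quadraticChar_dichotomy (h x (mem_expSupport.2 h0)) with h | h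
      · simp [h]
      · rw [h, ← pow_mul]; simp
  · push Not at h
    obtain ⟨x, hx, hF⟩ := h
    refine prod_eq_zero (mem_univ x) ?_
    simp [hF, mem_expSupport.1 hx]

/-- The sum of the weight over all monic polynomials of degree `n`. -/
noncomputable def monicSum (e : K → ℕ) (n : ℕ) : ℝ := ∑ F ∈ monics K n, weight e F

/-- The sum of the weight over the monic square-free polynomials of degree `n`. -/
noncomputable def sqfreeSum (e : K → ℕ) (n : ℕ) : ℝ := ∑ F ∈ family K n, weight e F

open Classical in
/-- The number of monic polynomials of degree `n` that do not vanish on `s`. -/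
noncomputable def nonvanishingCount (s : Finset K) (n : ℕ) : ℕ :=
  #{F ∈ monics K n | ∀ x ∈ s, F.eval x ≠ 0}

theorem sum_weight_sq (e : K → ℕ) (n : ℕ) :
    ∑ F ∈ monics K n, weight e F ^ 2 = nonvanishingCount (expSupport e) n := by
  classical
  simp [weight_sq, nonvanishingCount]

theorem abs_monicSum_le (e : K → ℕ) (n : ℕ) :
    |monicSum e n| ≤ (Fintype.card K : ℝ) ^ n := by
  refine (abs_sum_le_sum_abs _ _).trans ?_
  refine (sum_le_sum fun F _ => abs_weight_le_one e F).trans ?_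
  simp [card_monics]

/-- Sorting the monic polynomials `F = A² B`, with `B` square-free, by `deg A²` and `deg B`: the
weight of `A²` is the indicator that `A` does not vanish on the support of `e`. -/
theorem monicSum_eq_sum_antidiagonal (e : K → ℕ) (d : ℕ) :
    monicSum e d = ∑ p ∈ antidiagonal d,
      (if 2 ∣ p.1 then (nonvanishingCount (expSupport e) (p.1 / 2) : ℝ) else 0)
        * sqfreeSum e p.2 := by
  classical
  have hterm : ∀ p ∈ (antidiagonal d).filter (fun p => 2 ∣ p.1),
      (nonvanishingCount (expSupport e) (p.1 / 2) : ℝ) * sqfreeSum e p.2 =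
        ∑ AB ∈ monics K (p.1 / 2) ×ˢ family K p.2, weight e (AB.1 ^ 2 * AB.2) := by
    intro p _
    rw [← sum_weight_sq, sqfreeSum, sum_mul_sum, sum_product]
    refine sum_congr rfl fun A _ => sum_congr rfl fun B _ => ?_
    simp [sq, weight_mul]
  simp only [ite_mul, zero_mul]
  rw [← sum_filter, sum_congr rfl hterm, ← sum_sigma (f := fun z : (_ : ℕ × ℕ) × K[X] × K[X] =>
    weight e (z.2.1 ^ 2 * z.2.2)), monicSum]
  symm
  refine sum_nbij (fun z => z.2.1 ^ 2 * z.2.2) ?_ ?_ ?_ fun _ _ => rfl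
  · rintro ⟨⟨i, j⟩, A, B⟩ h
    simp only [mem_sigma, mem_filter, HasAntidiagonal.mem_antidiagonal, mem_product,
      mem_monics, mem_family] at h
    obtain ⟨⟨hd, hi⟩, ⟨hA, hAd⟩, hB, hBd, -⟩ := h
    refine mem_monics.2 ⟨(hA.pow 2).mul hB, ?_⟩
    rw [(hA.pow 2).natDegree_mul hB, hA.natDegree_pow]
    omega
  · rintro ⟨⟨i, j⟩, A, B⟩ h ⟨⟨i', j'⟩, A', B'⟩ h' heq
    simp only [coe_sigma, Set.mem_sigma_iff, mem_coe, mem_filter, HasAntidiagonal.mem_antidiagonal,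
      mem_product, mem_monics, mem_family] at h h'
    obtain ⟨⟨hd, hi⟩, ⟨hA, hAd⟩, hB, hBd, hBs⟩ := h
    obtain ⟨⟨hd', hi'⟩, ⟨hA', hAd'⟩, hB', hBd', hBs'⟩ := h'
    obtain ⟨rfl, rfl⟩ := eq_of_sq_mul_eq_sq_mul hA hA' hBs hBs' heq
    obtain rfl : j = j' := hBd ▸ hBd'
    obtain rfl : i = i' := by omega
    rfl
  · intro F hF
    obtain ⟨hF, hd⟩ := mem_monics.1 hF
    obtain ⟨A, B, hA, hB, hBs, rfl⟩ := exists_sq_mul_squarefree _ F hF rfl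
    refine ⟨⟨(2 * A.natDegree, B.natDegree), A, B⟩, ?_, rfl⟩
    rw [(hA.pow 2).natDegree_mul hB, hA.natDegree_pow] at hd
    simp [mem_monics, mem_family, hA, hB, hBs, hd]

open Classical in
/-- The monic polynomials not vanishing on `s` that do vanish at `a` are the products of `X - a`
and a monic polynomial of degree one less that does not vanish on `s`. -/
theorem nonvanishingCount_insert {s : Finset K} {a : K} (ha : a ∉ s) (n : ℕ) :
    nonvanishingCount (insert a s) (n + 1) + nonvanishingCount s n
      = nonvanishingCount s (n + 1) := by
  have h1 : nonvanishingCount s n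
      = #{F ∈ monics K (n + 1) | (∀ x ∈ s, F.eval x ≠ 0) ∧ F.eval a = 0} := by
    refine card_nbij (fun G => (X - C a) * G) ?_ ?_ ?_
    · intro G hG
      obtain ⟨hG, hs⟩ := mem_filter.1 hG
      obtain ⟨hm, hd⟩ := mem_monics.1 hG
      refine mem_filter.2 ⟨mem_monics.2 ⟨(monic_X_sub_C a).mul hm, ?_⟩, fun x hx => ?_, by simp⟩
      · rw [(monic_X_sub_C a).natDegree_mul hm, natDegree_X_sub_C, hd, add_comm]
      · have : x ≠ a := by rintro rfl; exact ha hx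
        simpa [sub_eq_zero, this] using hs x hx
    · intro G _ G' _ h
      exact mul_left_cancel₀ (X_sub_C_ne_zero a) h
    · intro F hF
      obtain ⟨hF, hs, h0⟩ := mem_filter.1 hF
      obtain ⟨hm, hd⟩ := mem_monics.1 hF
      obtain ⟨G, rfl⟩ := dvd_iff_isRoot.2 h0
      have hG : G.Monic := (monic_X_sub_C a).of_mul_monic_left hm
      refine ⟨G, mem_filter.2 ⟨mem_monics.2 ⟨hG, ?_⟩, fun x hx => ?_⟩, rfl⟩
      · rw [(monic_X_sub_C a).natDegree_mul hG, natDegree_X_sub_C] at hd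
        omega
      · have := hs x hx
        rw [eval_mul] at this
        exact right_ne_zero_of_mul this
  have h2 : nonvanishingCount (insert a s) (n + 1)
      = #{F ∈ monics K (n + 1) | (∀ x ∈ s, F.eval x ≠ 0) ∧ ¬ F.eval a = 0} := by
    unfold nonvanishingCount
    congr 1
    ext F
    simp [and_comm]
  have h3 := card_filter_add_card_filter_not
    (s := {F ∈ monics K (n + 1) | ∀ x ∈ s, F.eval x ≠ 0}) (fun F : K[X] => F.eval a = 0)
  rw [filter_filter, filter_filter] at h3
  rw [h1, h2, add_comm, h3]
  rfl

theorem nonvanishingCount_zero (s : Finset K) : nonvanishingCount s 0 = 1 := by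
  classical
  have : {F ∈ monics K 0 | ∀ x ∈ s, F.eval x ≠ 0} = {1} := by
    ext F
    simp only [mem_filter, mem_monics, mem_singleton]
    constructor
    · rintro ⟨⟨hm, hd⟩, -⟩
      exact eq_one_of_monic_natDegree_zero hm hd
    · rintro rfl
      simp
  rw [nonvanishingCount, this, card_singleton]

/-- The generating series of the monic polynomials not vanishing on `s`, which is
`(1 - u) ^ #s / (1 - q u)`. -/
theorem nonvanishingCount_series (s : Finset K) :
    (PowerSeries.mk fun n => (nonvanishingCount s n : ℝ))
        * (1 - PowerSeries.C (Fintype.card K : ℝ) * PowerSeries.X)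
      = (1 - PowerSeries.X) ^ #s := by
  classical
  induction s using Finset.induction_on with
  | empty =>
    ext n
    rw [mul_sub, mul_one, mul_left_comm, map_sub, PowerSeries.coeff_C_mul]
    cases n with
    | zero => simp [nonvanishingCount, card_monics]
    | succ n =>
      simp [PowerSeries.coeff_succ_mul_X, PowerSeries.coeff_one, nonvanishingCount, card_monics,
        pow_succ']
  | insert a s ha ih =>
    have h : (PowerSeries.mk fun n => (nonvanishingCount (insert a s) n : ℝ))
        = (PowerSeries.mk fun n => (nonvanishingCount s n : ℝ)) * (1 - PowerSeries.X) := by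
      ext n
      rw [mul_sub, mul_one, map_sub]
      cases n with
      | zero => simp [nonvanishingCount_zero]
      | succ n =>
        simp [PowerSeries.coeff_succ_mul_X, ← nonvanishingCount_insert ha n]
    rw [h, mul_right_comm, ih, card_insert_of_notMem ha, pow_succ]

end Weight

/-! ### The sieve series -/

section Series

/-- The series `(1 - q u) / (1 - u) ^ m`, the reciprocal of the generating series of the monic
polynomials not vanishing at `m` given points. -/
noncomputable def moebiusSeries (q m : ℕ) : PowerSeries ℝ :=
  (1 - PowerSeries.C (q : ℝ) * PowerSeries.X) * PowerSeries.mk fun a => (m.multichoose a : ℝ)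

theorem multichoose_series (m : ℕ) :
    (PowerSeries.mk fun a => (m.multichoose a : ℝ)) * (1 - PowerSeries.X) ^ m = 1 := by
  induction m with
  | zero =>
    ext n
    cases n <;> simp [PowerSeries.coeff_one]
  | succ m ih =>
    have h : (PowerSeries.mk fun a => ((m + 1).multichoose a : ℝ)) * (1 - PowerSeries.X)
        = PowerSeries.mk fun a => (m.multichoose a : ℝ) := by
      ext n
      rw [mul_sub, mul_one, map_sub]
      cases n with
      | zero => simp
      | succ n => simp [PowerSeries.coeff_succ_mul_X, Nat.multichoose_succ_succ]
    rw [pow_succ', ← mul_assoc, h, ih]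

theorem multichoose_le_pow (m a : ℕ) : m.multichoose a ≤ m ^ a := by
  induction a generalizing m with
  | zero => simp
  | succ a iha =>
    induction m with
    | zero => simp
    | succ m ihm =>
      rw [Nat.multichoose_succ_succ]
      calc m.multichoose (a + 1) + (m + 1).multichoose a
          ≤ m ^ (a + 1) + (m + 1) ^ a := add_le_add ihm (iha _)
        _ = m * m ^ a + (m + 1) ^ a := by rw [pow_succ']
        _ ≤ m * (m + 1) ^ a + (m + 1) ^ a := by gcongr; omega
        _ = (m + 1) ^ (a + 1) := by rw [pow_succ']; ring

theorem abs_coeff_moebiusSeries_le {q m : ℕ} (h : m ≤ q) (a : ℕ) :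
    |(moebiusSeries q m).coeff a| ≤ (q : ℝ) ^ a := by
  have hb : ∀ a, (m.multichoose a : ℝ) ≤ (q : ℝ) ^ a := fun a => by
    exact_mod_cast (multichoose_le_pow m a).trans (Nat.pow_le_pow_left h a)
  rw [moebiusSeries, sub_mul, one_mul, mul_assoc, map_sub, PowerSeries.coeff_C_mul]
  cases a with
  | zero => simp
  | succ a =>
    rw [PowerSeries.coeff_succ_X_mul, PowerSeries.coeff_mk, PowerSeries.coeff_mk]
    have h1 := hb (a + 1)
    have h2 := mul_le_mul_of_nonneg_left (hb a) (Nat.cast_nonneg (α := ℝ) q)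
    rw [← pow_succ'] at h2
    have h3 : (0 : ℝ) ≤ m.multichoose (a + 1) := Nat.cast_nonneg _
    have h4 : (0 : ℝ) ≤ q * m.multichoose a := by positivity
    rw [abs_le]
    constructor <;> linarith

theorem hasSum_multichoose (m : ℕ) {x : ℝ} (hx0 : 0 ≤ x) (hx : x < 1) :
    HasSum (fun a => (m.multichoose a : ℝ) * x ^ a) (((1 - x) ^ m)⁻¹) := by
  cases m with
  | zero =>
    convert hasSum_single (f := fun a => ((0 : ℕ).multichoose a : ℝ) * x ^ a) 0 ?_ using 1
    · simp
    · rintro (_ | a) ha <;> simp at ha ⊢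
  | succ m =>
    have := hasSum_choose_mul_geometric_of_norm_lt_one (𝕜 := ℝ) m (r := x)
      (by rwa [Real.norm_of_nonneg hx0])
    rw [one_div] at this
    have hc : ∀ a, (m + 1).multichoose a = (a + m).choose m := fun a => by
      rw [Nat.multichoose_eq, show m + 1 + a - 1 = a + m by omega, Nat.choose_symm_add]
    simpa only [hc] using this

theorem hasSum_moebiusSeries (q m : ℕ) {x : ℝ} (hx0 : 0 ≤ x) (hx : x < 1) :
    HasSum (fun a => (moebiusSeries q m).coeff a * x ^ a) ((1 - q * x) * ((1 - x) ^ m)⁻¹) := by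
  have h := hasSum_multichoose m hx0 hx
  have h' : HasSum (fun a => (if a = 0 then 0 else (m.multichoose (a - 1) : ℝ)) * x ^ a)
      (x * ((1 - x) ^ m)⁻¹) := by
    rw [← hasSum_nat_add_iff' 1]
    simpa [pow_succ', mul_left_comm] using h.mul_left x
  have h2 := h.sub (h'.mul_left (q : ℝ))
  have hv : (1 - q * x) * ((1 - x) ^ m)⁻¹
      = ((1 - x) ^ m)⁻¹ - q * (x * ((1 - x) ^ m)⁻¹) := by ring
  rw [hv]
  refine h2.congr_fun ?_
  · intro a
    rw [moebiusSeries, sub_mul, one_mul, mul_assoc, map_sub, PowerSeries.coeff_C_mul]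
    cases a with
    | zero => simp
    | succ a => rw [PowerSeries.coeff_succ_X_mul]; simp; ring

variable {K : Type*} [Field K] [Fintype K]

/-- The square-free sums are the convolution of the sums over all monic polynomials with the
coefficients of `(1 - q u²) / (1 - u²) ^ m`. -/
theorem sqfreeSum_eq (e : K → ℕ) (d : ℕ) :
    sqfreeSum e d = ∑ p ∈ antidiagonal d,
      ((moebiusSeries (Fintype.card K) #(expSupport e)).expand 2 two_ne_zero).coeff p.1
        * monicSum e p.2 := by
  set q := Fintype.card K
  set m := #(expSupport e)
  let P : PowerSeries ℝ := PowerSeries.mk fun n => (nonvanishingCount (expSupport e) n : ℝ)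
  let N : PowerSeries ℝ := PowerSeries.mk (sqfreeSum e)
  have hT : PowerSeries.mk (monicSum e) = P.expand 2 two_ne_zero * N := by
    ext d
    rw [PowerSeries.coeff_mk, PowerSeries.coeff_mul, monicSum_eq_sum_antidiagonal]
    simp [PowerSeries.coeff_expand, P, N]
  have hPM : P * moebiusSeries q m = 1 := by
    rw [moebiusSeries, ← mul_assoc, nonvanishingCount_series, mul_comm, multichoose_series]
  have hN : N = (moebiusSeries q m).expand 2 two_ne_zero * PowerSeries.mk (monicSum e) := by
    rw [hT, ← mul_assoc, ← map_mul, mul_comm _ P, hPM, map_one, one_mul]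
  have := congrArg (PowerSeries.coeff d) hN
  rw [PowerSeries.coeff_mul] at this
  simpa [N] using this

end Series

/-! ### Local factors -/

section LocalFactors

/-- The mean of `χ(a) ^ j` over `a ∈ 𝔽_q`, for `χ` the quadratic character. -/
noncomputable def charMean (q j : ℕ) : ℝ := if j = 0 then 1 else if Even j then 1 - 1 / q else 0

/-- The `j`-th moment of the trinomial law. -/
noncomputable def trinomialMoment (q j : ℕ) : ℝ :=
  if j = 0 then 1 else if Even j then q / (q + 1) else 0

theorem charMean_nonneg {q : ℕ} (hq : 0 < q) (j : ℕ) : 0 ≤ charMean q j := by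
  have : (1 : ℝ) ≤ q := by exact_mod_cast hq
  have h : 1 / (q : ℝ) ≤ 1 := by rw [div_le_one (by linarith)]; exact this
  rw [charMean]; split_ifs <;> linarith

theorem charMean_le_one (q j : ℕ) : charMean q j ≤ 1 := by
  have h : 0 ≤ 1 / (q : ℝ) := by positivity
  rw [charMean]; split_ifs <;> linarith

theorem trinomialMoment_nonneg (q j : ℕ) : 0 ≤ trinomialMoment q j := by
  rw [trinomialMoment]; split_ifs <;> positivity

theorem trinomialMoment_le_one (q j : ℕ) : trinomialMoment q j ≤ 1 := by
  rw [trinomialMoment]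
  split_ifs
  · rfl
  · rw [div_le_one (by positivity)]; linarith
  · exact zero_le_one

variable {K : Type*} [Field K] [Fintype K]

open Classical in
theorem sum_quadraticChar_pow (hq : Odd (Fintype.card K)) (j : ℕ) :
    ∑ a : K, (quadraticChar K a : ℝ) ^ j = Fintype.card K * charMean (Fintype.card K) j := by
  have hq0 : (Fintype.card K : ℝ) ≠ 0 := by exact_mod_cast Fintype.card_ne_zero
  rw [charMean]
  split_ifs with h0 he
  · simp [h0]
  · have h : ∀ a : K, (quadraticChar K a : ℝ) ^ j = 1 - if a = 0 then 1 else 0 := by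
      intro a
      rcases eq_or_ne a 0 with rfl | ha
      · simp [h0]
      · rcases quadraticChar_dichotomy ha with h | h <;> simp [h, ha, he.neg_one_pow]
    simp_rw [h]
    simp
    field_simp
  · rw [Nat.not_even_iff_odd] at he
    have h : ∀ a : K, (quadraticChar K a : ℝ) ^ j = (quadraticChar K a : ℤ) := by
      intro a
      rcases eq_or_ne a 0 with rfl | ha
      · simp [h0]
      · rcases quadraticChar_dichotomy ha with h | h <;> simp [h, he.neg_one_pow]
    simp_rw [h]
    rw [← Int.cast_sum, quadraticChar_sum_zero]
    · simp
    · intro h2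
      have := FiniteField.even_card_of_char_two h2
      have := Nat.odd_iff.1 hq
      omega

/-- As soon as the degree is at least the number of points involved, the sum of the weight over
monic polynomials is given by its local means. -/
theorem monicSum_eq (hq : Odd (Fintype.card K)) (e : K → ℕ) {n : ℕ} (hn : #(expSupport e) ≤ n) :
    monicSum e n = (∏ x, charMean (Fintype.card K) (e x)) * (Fintype.card K : ℝ) ^ n := by
  classical
  have hq0 : (Fintype.card K : ℝ) ≠ 0 := by exact_mod_cast Fintype.card_ne_zero
  have hw : ∀ (f : K → ℕ → ℝ), (∀ x, f x 0 = 1) →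
      ∏ x, f x (e x) = ∏ x : expSupport e, f x (e x) := by
    intro f hf
    rw [prod_coe_sort (expSupport e) (fun x => f x (e x))]
    symm
    refine prod_subset (subset_univ _) fun x _ hx => ?_
    rw [mem_expSupport, not_not] at hx
    rw [hx, hf]
  have h1 := sum_monics_eval_mul_card (expSupport e) hn fun v =>
    ∏ x : expSupport e, (quadraticChar K (v x) : ℝ) ^ e x
  have h2 : ∑ v : expSupport e → K, ∏ x : expSupport e, (quadraticChar K (v x) : ℝ) ^ e x
      = (Fintype.card K : ℝ) ^ #(expSupport e) * ∏ x, charMean (Fintype.card K) (e x) := by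
    rw [hw (fun _ j => charMean (Fintype.card K) j) (fun _ => by simp [charMean]),
      ← Fintype.piFinset_univ,
      ← prod_univ_sum (fun _ => univ) (fun (x : expSupport e) a => (quadraticChar K a : ℝ) ^ e x)]
    simp_rw [sum_quadraticChar_pow hq]
    rw [prod_mul_distrib]
    simp
  have h3 : monicSum e n = ∑ F ∈ monics K n,
      ∏ x : expSupport e, (quadraticChar K (F.eval (x : K)) : ℝ) ^ e x :=
    sum_congr rfl fun F _ => hw (fun x j => (quadraticChar K (F.eval x) : ℝ) ^ j) (by simp)
  rw [← h3, h2] at h1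
  apply mul_right_cancel₀ (pow_ne_zero #(expSupport e) hq0)
  rw [h1]; ring

end LocalFactors

/-! ### Means over square-free polynomials -/

section Sieve

theorem geom_sum_le_pow {q : ℝ} (hq : 2 ≤ q) (m : ℕ) : ∑ j ∈ range m, q ^ j ≤ q ^ m := by
  induction m with
  | zero => simp
  | succ m ih =>
    rw [sum_range_succ, pow_succ]
    have : 0 ≤ q ^ m := by positivity
    nlinarith

/-- Convolving a sequence `T` that agrees with `c q ^ b` from `b = m` on with a sequence `v` of
size `q ^ (i / 2)`: the main term comes from the full sum `∑ vᵢ q ^ (-i) = L`. Here `r = √q`. -/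
theorem abs_convolution_sub_le {r c L : ℝ} {v T : ℕ → ℝ} {m : ℕ} (hr : 3 / 2 ≤ r)
    (hc0 : 0 ≤ c) (hc1 : c ≤ 1) (hv : ∀ i, |v i| ≤ r ^ i)
    (hT : ∀ b, m ≤ b → T b = c * (r ^ 2) ^ b)
    (hTs : ∀ b, |T b - c * (r ^ 2) ^ b| ≤ 2 * (r ^ 2) ^ b)
    (hL : HasSum (fun i => v i * (1 / r ^ 2) ^ i) L) (d : ℕ) :
    |∑ p ∈ antidiagonal d, v p.1 * T p.2 - c * (r ^ 2) ^ d * L| ≤ 4 * r ^ d * (r ^ 2) ^ m := by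
  have hr0 : 0 < r := by linarith
  -- the truncated tail of the series for `L`
  have htail : |∑ i ∈ range (d + 1), v i * (1 / r ^ 2) ^ i - L| ≤ 2 * (1 / r) ^ d := by
    have h1r : 1 / r < 1 := by rw [div_lt_one hr0]; linarith
    have hu : ∀ n, dist (∑ i ∈ range n, v i * (1 / r ^ 2) ^ i)
        (∑ i ∈ range (n + 1), v i * (1 / r ^ 2) ^ i) ≤ 1 * (1 / r) ^ n := by
      intro n
      rw [sum_range_succ, dist_self_add_right, norm_mul, Real.norm_eq_abs, Real.norm_eq_abs,
        abs_of_nonneg (a := (1 / r ^ 2) ^ n) (by positivity)]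
      calc |v n| * (1 / r ^ 2) ^ n ≤ r ^ n * (1 / r ^ 2) ^ n := by gcongr; exact hv n
        _ = 1 * (1 / r) ^ n := by rw [← mul_pow]; field_simp
    have h := dist_le_of_le_geometric_of_tendsto (1 / r) 1 h1r hu hL.tendsto_sum_nat (d + 1)
    rw [Real.dist_eq] at h
    refine h.trans ?_
    rw [one_mul, div_le_iff₀ (by linarith), pow_succ]
    have h3 : 1 / r ≤ 2 * (1 - 1 / r) := by
      have : 1 / r ≤ 2 / 3 := by rw [div_le_div_iff₀ hr0 (by norm_num)]; linarith
      linarith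
    have : 0 ≤ (1 / r) ^ d := by positivity
    nlinarith
  have hmain : ∑ p ∈ antidiagonal d, v p.1 * (c * (r ^ 2) ^ p.2)
      = c * (r ^ 2) ^ d * ∑ i ∈ range (d + 1), v i * (1 / r ^ 2) ^ i := by
    rw [Nat.sum_antidiagonal_eq_sum_range_succ_mk, mul_sum]
    refine sum_congr rfl fun i hi => ?_
    have hid : i ≤ d := Nat.lt_succ_iff.1 (mem_range.1 hi)
    have : (r ^ 2) ^ d = (r ^ 2) ^ (d - i) * (r ^ 2) ^ i := by
      rw [← pow_add, Nat.sub_add_cancel hid]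
    rw [this, one_div, inv_pow]
    field_simp
  -- the contribution of the degrees below `m`
  have herr : |∑ p ∈ antidiagonal d, v p.1 * (T p.2 - c * (r ^ 2) ^ p.2)|
      ≤ 2 * r ^ d * (r ^ 2) ^ m := by
    calc |∑ p ∈ antidiagonal d, v p.1 * (T p.2 - c * (r ^ 2) ^ p.2)|
        ≤ ∑ p ∈ antidiagonal d, |v p.1 * (T p.2 - c * (r ^ 2) ^ p.2)| := abs_sum_le_sum_abs _ _
      _ ≤ ∑ p ∈ antidiagonal d, if p.2 < m then 2 * r ^ d * (r ^ 2) ^ p.2 else 0 := by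
          refine sum_le_sum fun p hp => ?_
          split_ifs with h
          · rw [← HasAntidiagonal.mem_antidiagonal.1 hp, abs_mul, pow_add]
            have h1 : |v p.1| * |T p.2 - c * (r ^ 2) ^ p.2| ≤ r ^ p.1 * (2 * (r ^ 2) ^ p.2) :=
              mul_le_mul (hv _) (hTs _) (abs_nonneg _) (by positivity)
            have h2 : 1 ≤ r ^ p.2 := one_le_pow₀ (by linarith)
            have h3 : 0 ≤ r ^ p.1 * (2 * (r ^ 2) ^ p.2) := by positivity
            nlinarith
          · rw [hT _ (not_lt.1 h)]; simp
      _ = ∑ j ∈ range (d + 1), if j < m then 2 * r ^ d * (r ^ 2) ^ j else 0 := by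
          rw [← Nat.sum_antidiagonal_swap, Nat.sum_antidiagonal_eq_sum_range_succ_mk]
          rfl
      _ ≤ ∑ j ∈ range m, 2 * r ^ d * (r ^ 2) ^ j := by
          rw [← sum_filter]
          refine sum_le_sum_of_subset_of_nonneg ?_ fun _ _ _ => by positivity
          intro j hj
          exact mem_range.2 (mem_filter.1 hj).2
      _ ≤ 2 * r ^ d * (r ^ 2) ^ m := by
          rw [← mul_sum]
          exact mul_le_mul_of_nonneg_left (geom_sum_le_pow (by nlinarith) m) (by positivity)
  have hsplit : ∑ p ∈ antidiagonal d, v p.1 * T p.2 - c * (r ^ 2) ^ d * L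
      = c * (r ^ 2) ^ d * (∑ i ∈ range (d + 1), v i * (1 / r ^ 2) ^ i - L)
        + ∑ p ∈ antidiagonal d, v p.1 * (T p.2 - c * (r ^ 2) ^ p.2) := by
    simp_rw [mul_sub]
    rw [sum_sub_distrib, hmain]; ring
  rw [hsplit]
  refine (abs_add_le _ _).trans ?_
  have h1 : |c * (r ^ 2) ^ d * (∑ i ∈ range (d + 1), v i * (1 / r ^ 2) ^ i - L)| ≤ 2 * r ^ d := by
    rw [abs_mul, abs_of_nonneg (a := c * (r ^ 2) ^ d) (by positivity)]
    calc c * (r ^ 2) ^ d * |∑ i ∈ range (d + 1), v i * (1 / r ^ 2) ^ i - L|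
        ≤ 1 * (r ^ 2) ^ d * (2 * (1 / r) ^ d) := by gcongr
      _ = 2 * r ^ d := by
          rw [one_mul, mul_left_comm, ← mul_pow]
          congr 2; field_simp
  have h2 : 1 ≤ (r ^ 2) ^ m := one_le_pow₀ (by nlinarith)
  have h3 : 0 ≤ r ^ d := by positivity
  nlinarith

theorem hasSum_coeff_expand_two {f : PowerSeries ℝ} {y L : ℝ}
    (h : HasSum (fun a => f.coeff a * (y ^ 2) ^ a) L) :
    HasSum (fun i => (f.expand 2 two_ne_zero).coeff i * y ^ i) L := by
  have hinj : Function.Injective fun a : ℕ => 2 * a := fun a b h => by simpa using h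
  refine (hinj.hasSum_iff fun i hi => ?_).1 ?_
  · rw [PowerSeries.coeff_expand, if_neg, zero_mul]
    rintro ⟨a, rfl⟩
    exact hi ⟨a, rfl⟩
  · simpa [Function.comp_def, pow_mul] using h

variable {K : Type*} [Field K] [Fintype K]

theorem three_le_card (hq : Odd (Fintype.card K)) : 3 ≤ Fintype.card K := by
  have h1 : 1 < Fintype.card K := Fintype.one_lt_card
  obtain ⟨j, hj⟩ := hq
  omega

/-- The case of the empty exponent vector, where the sieve series is `1 - q u²`. -/
theorem card_family {d : ℕ} (hd : 2 ≤ d) :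
    ((family K d).card : ℝ) = (Fintype.card K : ℝ) ^ d * (1 - 1 / Fintype.card K) := by
  have hq0 : (Fintype.card K : ℝ) ≠ 0 := by exact_mod_cast Fintype.card_ne_zero
  have hw : ∀ F : K[X], weight (0 : K → ℕ) F = 1 := by simp [weight]
  have hs : expSupport (0 : K → ℕ) = ∅ := by simp [expSupport]
  have hT : ∀ n, monicSum (0 : K → ℕ) n = (Fintype.card K : ℝ) ^ n := by
    simp [monicSum, hw, card_monics]
  have hM : (moebiusSeries (Fintype.card K) 0).expand 2 two_ne_zero
      = 1 - PowerSeries.C (Fintype.card K : ℝ) * PowerSeries.X ^ 2 := by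
    have h1 := multichoose_series 0
    rw [pow_zero, mul_one] at h1
    rw [moebiusSeries, h1, mul_one, map_sub, map_one, map_mul, PowerSeries.expand_C,
      PowerSeries.expand_X]
  have h : sqfreeSum (0 : K → ℕ) d
      = (((moebiusSeries (Fintype.card K) 0).expand 2 two_ne_zero)
        * PowerSeries.mk (monicSum (0 : K → ℕ))).coeff d := by
    rw [sqfreeSum_eq, PowerSeries.coeff_mul, hs, card_empty]
    simp
  obtain ⟨n, rfl⟩ : ∃ n, d = n + 2 := ⟨d - 2, by omega⟩
  rw [hM, sub_mul, one_mul, mul_assoc, map_sub, PowerSeries.coeff_C_mul,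
    PowerSeries.coeff_X_pow_mul, PowerSeries.coeff_mk, PowerSeries.coeff_mk, hT, hT] at h
  have hN : sqfreeSum (0 : K → ℕ) (n + 2) = (family K (n + 2)).card := by simp [sqfreeSum, hw]
  rw [← hN, h]
  field_simp
  ring

/-- The mean of the weight over the monic square-free polynomials of degree `d` is a product of
moments of the trinomial law, up to `O(q ^ (∑ e - d / 2))`. -/
theorem abs_sqfreeSum_div_sub_le (hq : Odd (Fintype.card K)) (e : K → ℕ) (d : ℕ) :
    |sqfreeSum e d / (family K d).card - ∏ x, trinomialMoment (Fintype.card K) (e x)|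
      ≤ 6 * (Fintype.card K : ℝ) ^ (∑ x, e x) / √(Fintype.card K : ℝ) ^ d := by
  classical
  set q := Fintype.card K with hqdef
  set m := #(expSupport e) with hm
  set r := √(q : ℝ) with hrdef
  have hq3 : (3 : ℝ) ≤ q := by exact_mod_cast three_le_card hq
  have hr2 : r ^ 2 = q := Real.sq_sqrt (by linarith)
  have hr : 3 / 2 ≤ r := Real.le_sqrt_of_sq_le (by linarith)
  have hmk : m ≤ ∑ x, e x := by
    rw [hm, card_eq_sum_ones]
    refine (sum_le_sum fun x hx => Nat.one_le_iff_ne_zero.2 (mem_expSupport.1 hx)).trans ?_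
    exact sum_le_sum_of_subset (subset_univ _)
  have hmq : m ≤ q := card_le_univ _
  have hF : (0 : ℝ) < (family K d).card := by
    exact_mod_cast card_pos.2 (family_nonempty K d)
  rw [le_div_iff₀ (by positivity)]
  rcases Nat.lt_or_ge d 2 with hd | hd
  · -- in degree at most one the bound is trivial, unless nothing is being averaged
    rcases Nat.eq_zero_or_pos m with h0 | h0
    · have he : ∀ x, e x = 0 := by
        intro x
        by_contra h
        have := mem_expSupport.2 h
        rw [card_eq_zero.1 h0] at this
        simp at this
      have hN : sqfreeSum e d = (family K d).card := by simp [sqfreeSum, weight, he]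
      rw [hN, div_self hF.ne']
      simp [he, trinomialMoment]
    · have h1 : |sqfreeSum e d / (family K d).card| ≤ 1 := by
        rw [abs_div, abs_of_pos hF, div_le_one hF]
        refine (abs_sum_le_sum_abs _ _).trans
          ((sum_le_sum fun F _ => abs_weight_le_one e F).trans ?_)
        simp
      have h2 : |∏ x, trinomialMoment q (e x)| ≤ 1 := by
        rw [abs_of_nonneg (prod_nonneg fun _ _ => trinomialMoment_nonneg _ _)]
        exact prod_le_one (fun _ _ => trinomialMoment_nonneg _ _)
          fun _ _ => trinomialMoment_le_one _ _
      have h3 := (abs_sub (sqfreeSum e d / (family K d).card)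
        (∏ x, trinomialMoment q (e x))).trans (add_le_add h1 h2)
      have h4 : r ^ d ≤ (q : ℝ) ^ (∑ x, e x) := by
        calc r ^ d ≤ r ^ 2 := pow_le_pow_right₀ (by linarith) hd.le
          _ = (q : ℝ) ^ 1 := by rw [hr2, pow_one]
          _ ≤ _ := pow_le_pow_right₀ (by linarith) (h0.trans_le hmk)
      have h5 : 0 < r ^ d := by positivity
      nlinarith
  · have hx0 : (0 : ℝ) ≤ (1 / r ^ 2) ^ 2 := by positivity
    have hx1 : ((1 : ℝ) / r ^ 2) ^ 2 < 1 := by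
      rw [hr2, div_pow, one_pow, div_lt_one (by positivity)]
      nlinarith
    have hv : ∀ i, |((moebiusSeries q m).expand 2 two_ne_zero).coeff i| ≤ r ^ i := by
      intro i
      rw [PowerSeries.coeff_expand]
      split_ifs with h
      · obtain ⟨a, rfl⟩ := h
        rw [Nat.mul_div_cancel_left _ two_pos, pow_mul, hr2]
        exact abs_coeff_moebiusSeries_le hmq a
      · rw [abs_zero]; positivity
    have hc0 : 0 ≤ ∏ x, charMean q (e x) :=
      prod_nonneg fun _ _ => charMean_nonneg Fintype.card_pos _
    have hc1 : ∏ x, charMean q (e x) ≤ 1 :=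
      prod_le_one (fun _ _ => charMean_nonneg Fintype.card_pos _) fun _ _ => charMean_le_one _ _
    have key := abs_convolution_sub_le hr hc0 hc1 hv (T := monicSum e) (m := m)
      (fun b hb => by rw [hr2]; exact monicSum_eq hq e hb)
      (fun b => by
        have h1 := abs_monicSum_le e b
        rw [hr2]
        have h2 : |(∏ x, charMean q (e x)) * (q : ℝ) ^ b| ≤ (q : ℝ) ^ b := by
          rw [abs_of_nonneg (by positivity)]
          exact mul_le_of_le_one_left (by positivity) hc1
        have := abs_sub (monicSum e b) ((∏ x, charMean q (e x)) * (q : ℝ) ^ b)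
        linarith)
      (hasSum_coeff_expand_two (hasSum_moebiusSeries q m hx0 hx1)) d
    rw [← sqfreeSum_eq, hr2] at key
    -- the local factors at the points of the support
    have hloc : (∏ x, charMean q (e x)) * ((1 - (1 / (q : ℝ)) ^ 2) ^ m)⁻¹
        = ∏ x, trinomialMoment q (e x) := by
      have hp : (1 - (1 / (q : ℝ)) ^ 2) ^ m
          = ∏ x, if e x ≠ 0 then 1 - (1 / (q : ℝ)) ^ 2 else 1 := by
        rw [prod_ite]; simp [hm, expSupport]
      have hne : (q : ℝ) ^ 2 - 1 ≠ 0 := by nlinarith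
      rw [hp, ← prod_inv_distrib, ← prod_mul_distrib]
      refine prod_congr rfl fun x _ => ?_
      rw [charMean, trinomialMoment]
      split_ifs with h h' h'
      · exact absurd h h'
      · simp
      · field_simp
        ring
      · simp
    have hmain : (∏ x, charMean q (e x)) * (q : ℝ) ^ d
          * ((1 - q * (1 / (q : ℝ)) ^ 2) * ((1 - (1 / (q : ℝ)) ^ 2) ^ m)⁻¹)
        = (family K d).card * ∏ x, trinomialMoment q (e x) := by
      rw [← hloc, card_family hd]
      have : 1 - (q : ℝ) * (1 / (q : ℝ)) ^ 2 = 1 - 1 / q := by field_simp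
      rw [this]; ring
    rw [hmain] at key
    have hFd : (2 / 3) * (q : ℝ) ^ d ≤ (family K d).card := by
      rw [card_family hd, mul_comm]
      have : 1 / (q : ℝ) ≤ 1 / 3 := one_div_le_one_div_of_le (by norm_num) hq3
      gcongr
      linarith
    have hdiv : sqfreeSum e d / (family K d).card - ∏ x, trinomialMoment q (e x)
        = (sqfreeSum e d - (family K d).card * ∏ x, trinomialMoment q (e x))
          / (family K d).card := by
      field_simp
    have hrr : r ^ d * r ^ d = (q : ℝ) ^ d := by rw [← mul_pow, ← sq, hr2]
    rw [hdiv, abs_div, abs_of_pos hF, div_mul_eq_mul_div, div_le_iff₀ hF]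
    calc |sqfreeSum e d - (family K d).card * ∏ x, trinomialMoment q (e x)| * r ^ d
        ≤ 4 * r ^ d * (q : ℝ) ^ m * r ^ d := by gcongr
      _ = 4 * (q : ℝ) ^ m * (q : ℝ) ^ d := by rw [← hrr]; ring
      _ ≤ 4 * (q : ℝ) ^ (∑ x, e x) * (q : ℝ) ^ d := by
          gcongr
          linarith
      _ = 6 * (q : ℝ) ^ (∑ x, e x) * (2 / 3 * (q : ℝ) ^ d) := by ring
      _ ≤ 6 * (q : ℝ) ^ (∑ x, e x) * (family K d).card := by gcongr

end Sieve

/-! ### Moments of sums of trinomial variables -/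

section Trinomial

/-- The exponential generating series of the moments of the trinomial law. -/
noncomputable def trinomialSeries (q : ℕ) : PowerSeries ℝ :=
  PowerSeries.mk fun j => trinomialMoment q j / j.factorial

/-- The `k`-th moment of `(X₁ + ⋯ + X_q) / √q`, for independent trinomial variables `Xᵢ`. -/
noncomputable def trinomialSumMoment (q k : ℕ) : ℝ :=
  k.factorial * (trinomialSeries q ^ q).coeff k / √(q : ℝ) ^ k

/-- The multinomial expansion of the moments of a sum of independent trinomial variables, read as a
coefficient of a power of their exponential generating series. -/
theorem sum_multinomial_prod_trinomialMoment {ι : Type*} [Fintype ι] [DecidableEq ι] (q k : ℕ) :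
    ∑ e ∈ piAntidiag (univ : Finset ι) k,
      (Nat.multinomial univ e : ℝ) * ∏ i, trinomialMoment q (e i)
      = k.factorial * (trinomialSeries q ^ Fintype.card ι).coeff k := by
  have h : trinomialSeries q ^ Fintype.card ι = ∏ _i : ι, trinomialSeries q := by simp
  rw [h, PowerSeries.coeff_prod, mul_sum]
  symm
  refine sum_nbij (fun l i => l i) ?_ ?_ ?_ ?_
  · intro l hl
    have := (mem_finsuppAntidiag.1 hl).1
    simpa using this
  · intro l _ l' _ h
    exact DFunLike.coe_injective h
  · intro e he
    refine ⟨Finsupp.equivFunOnFinite.symm e, ?_, rfl⟩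
    have := (mem_piAntidiag.1 he).1
    simpa [mem_finsuppAntidiag] using this
  · intro l hl
    have hs : ∑ i, l i = k := (mem_finsuppAntidiag.1 hl).1
    have hm := Nat.multinomial_spec univ (fun i => l i)
    rw [hs] at hm
    have hm' : (∏ i, ((l i).factorial : ℝ)) * (Nat.multinomial univ fun i => l i)
        = k.factorial := by
      exact_mod_cast hm
    have hf : (∏ i, ((l i).factorial : ℝ)) ≠ 0 := prod_ne_zero_iff.2 fun i _ => by positivity
    rw [← hm']
    simp only [trinomialSeries, PowerSeries.coeff_mk, prod_div_distrib]
    field_simp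

theorem integral_trinomialLaw {q : ℕ} (f : ℝ → ℝ) :
    ∫ x, f x ∂(trinomialLaw q) = 1 / (q + 1) * f 0 + 1 / (2 * (1 + (q : ℝ)⁻¹)) * f 1
      + 1 / (2 * (1 + (q : ℝ)⁻¹)) * f (-1) := by
  have hi : ∀ a c : ℝ, Integrable f (ENNReal.ofReal c • Measure.dirac a) := fun a c =>
    (integrable_dirac (by simp)).smul_measure ENNReal.ofReal_ne_top
  have h1 : (0 : ℝ) ≤ 1 / (q + 1) := by positivity
  have h2 : (0 : ℝ) ≤ 1 / (2 * (1 + (q : ℝ)⁻¹)) := by positivity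
  rw [trinomialLaw, integral_add_measure ((hi _ _).add_measure (hi _ _)) (hi _ _),
    integral_add_measure (hi _ _) (hi _ _)]
  simp only [integral_smul_measure, integral_dirac, ENNReal.toReal_ofReal h1,
    ENNReal.toReal_ofReal h2, smul_eq_mul]

theorem integral_pow_trinomialLaw {q : ℕ} (hq : 0 < q) (j : ℕ) :
    ∫ x, x ^ j ∂(trinomialLaw q) = trinomialMoment q j := by
  have hq' : (0 : ℝ) < q := by exact_mod_cast hq
  rw [integral_trinomialLaw, trinomialMoment]
  split_ifs with h0 he
  · simp [h0]; field_simp; ring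
  · simp [h0, he.neg_one_pow]; field_simp; ring
  · rw [Nat.not_even_iff_odd] at he
    simp [h0, he.neg_one_pow]

theorem ae_abs_le_one_trinomialLaw (q : ℕ) : ∀ᵐ x ∂(trinomialLaw q), |x| ≤ 1 := by
  have h : MeasurableSet {x : ℝ | |x| ≤ 1} := measurableSet_le (by fun_prop) (by fun_prop)
  have hd : ∀ a : ℝ, |a| ≤ 1 → ∀ c : ENNReal, ∀ᵐ x ∂(c • Measure.dirac a), |x| ≤ 1 :=
    fun a ha c => Measure.ae_smul_measure ((ae_dirac_iff h).2 ha) c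
  rw [trinomialLaw, ae_add_measure_iff, ae_add_measure_iff]
  exact ⟨⟨hd _ (by simp) _, hd _ (by simp) _⟩, hd _ (by simp) _⟩

/-- `trinomialSumMoment` is the moment it stands for. -/
theorem integral_sum_pow {ι Ω : Type*} [Fintype ι] [MeasurableSpace Ω] (P : Measure Ω)
    [IsProbabilityMeasure P] {q : ℕ} (hq : 0 < q) (hι : Fintype.card ι = q) (Y : ι → Ω → ℝ)
    (hY : iIndepFun Y P) (hlaw : ∀ i, HasLaw (Y i) (trinomialLaw q) P) (k : ℕ) :
    ∫ ω, ((∑ i, Y i ω) / √(q : ℝ)) ^ k ∂P = trinomialSumMoment q k := by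
  classical
  have hm : ∀ i, AEMeasurable (Y i) P := fun i => (hlaw i).aemeasurable
  have hb : ∀ i, ∀ᵐ ω ∂P, |Y i ω| ≤ 1 := fun i =>
    ((hlaw i).ae_iff (p := fun x : ℝ => |x| ≤ 1)
      (measurableSet_setOfPred.1 (measurableSet_le (by fun_prop) (by fun_prop)))).2
      (ae_abs_le_one_trinomialLaw q)
  have hint : ∀ e : ι → ℕ, Integrable (fun ω => ∏ i, Y i ω ^ e i) P := by
    intro e
    refine Integrable.of_bound (C := 1) ?_ ?_
    · exact (Finset.aemeasurable_fun_prod univ fun i _ => (hm i).pow_const _).aestronglyMeasurable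
    · filter_upwards [ae_all_iff.2 hb] with ω hω
      rw [Real.norm_eq_abs, abs_prod]
      refine prod_le_one (fun _ _ => abs_nonneg _) fun i _ => ?_
      rw [abs_pow]
      exact pow_le_one₀ (abs_nonneg _) (hω i)
  have hE : ∀ e : ι → ℕ, ∫ ω, ∏ i, Y i ω ^ e i ∂P = ∏ i, trinomialMoment q (e i) := by
    intro e
    rw [hY.integral_fun_prod_comp (f := fun i x => x ^ e i) hm
      (fun i => (by fun_prop : Measurable fun x : ℝ => x ^ e i).aestronglyMeasurable)]
    refine prod_congr rfl fun i _ => ?_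
    rw [← integral_pow_trinomialLaw hq]
    exact (hlaw i).integral_comp (f := fun x => x ^ e i)
      (by fun_prop : Measurable fun x : ℝ => x ^ e i).aestronglyMeasurable
  simp_rw [div_pow, sum_pow_eq_sum_piAntidiag]
  rw [integral_div, integral_finsetSum _ fun e _ => (hint e).const_mul _]
  simp_rw [integral_const_mul, hE]
  rw [sum_multinomial_prod_trinomialMoment, hι, trinomialSumMoment]

end Trinomial

/-! ### Comparison of the moments -/

section Comparison

variable {K : Type*} [Field K] [Fintype K]

open Classical in
/-- Expanding `S(F) ^ k` over exponent vectors. -/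
theorem moment_eq (k d : ℕ) : moment K k d = (∑ e ∈ piAntidiag (univ : Finset K) k,
    (Nat.multinomial univ e : ℝ) * (sqfreeSum e d / (family K d).card))
      / √(Fintype.card K : ℝ) ^ k := by
  have h : ∀ F : K[X], normSum F ^ k = (∑ e ∈ piAntidiag (univ : Finset K) k,
      (Nat.multinomial univ e : ℝ) * weight e F) / √(Fintype.card K : ℝ) ^ k := by
    intro F
    rw [normSum, div_pow, charSum, Int.cast_sum, sum_pow_eq_sum_piAntidiag]
    rfl
  rw [moment]
  simp_rw [h]
  rw [← sum_div, sum_comm, ← mul_div_assoc, mul_sum]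
  congr 1
  refine sum_congr rfl fun e _ => ?_
  rw [sqfreeSum, ← mul_sum]
  ring

theorem abs_moment_sub_le (hq : Odd (Fintype.card K)) (k d : ℕ) :
    |moment K k d - trinomialSumMoment (Fintype.card K) k|
      ≤ 6 * (Fintype.card K : ℝ) ^ ((3 * (k : ℝ) - (d : ℝ)) / 2) := by
  classical
  set q := Fintype.card K with hqdef
  have hq3 : (3 : ℝ) ≤ q := by exact_mod_cast three_le_card hq
  have hq0 : (0 : ℝ) < q := by linarith
  have hr : 0 < √(q : ℝ) := Real.sqrt_pos.2 hq0
  have hpow : ∀ n : ℕ, √(q : ℝ) ^ n = (q : ℝ) ^ ((n : ℝ) / 2) := by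
    intro n
    rw [Real.sqrt_eq_rpow, ← Real.rpow_natCast, ← Real.rpow_mul hq0.le]
    congr 1; ring
  have htot : ∑ e ∈ piAntidiag (univ : Finset K) k, (Nat.multinomial univ e : ℝ) = (q : ℝ) ^ k := by
    have := sum_pow_eq_sum_piAntidiag (univ : Finset K) (fun _ => (1 : ℝ)) k
    simpa using this.symm
  rw [moment_eq, trinomialSumMoment, ← sum_multinomial_prod_trinomialMoment (ι := K), ← sub_div,
    ← sum_sub_distrib, abs_div, abs_of_pos (pow_pos hr k), div_le_iff₀ (pow_pos hr k)]
  calc |∑ e ∈ piAntidiag (univ : Finset K) k,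
          ((Nat.multinomial univ e : ℝ) * (sqfreeSum e d / (family K d).card)
            - (Nat.multinomial univ e : ℝ) * ∏ i, trinomialMoment q (e i))|
      ≤ ∑ e ∈ piAntidiag (univ : Finset K) k,
          (Nat.multinomial univ e : ℝ) * (6 * (q : ℝ) ^ k / √(q : ℝ) ^ d) := by
        refine (abs_sum_le_sum_abs _ _).trans (sum_le_sum fun e he => ?_)
        rw [← mul_sub, abs_mul, Nat.abs_cast, ← (mem_piAntidiag.1 he).1]
        exact mul_le_mul_of_nonneg_left (abs_sqfreeSum_div_sub_le hq e d) (Nat.cast_nonneg _)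
    _ = 6 * (q : ℝ) ^ ((3 * (k : ℝ) - (d : ℝ)) / 2) * √(q : ℝ) ^ k := by
        rw [← sum_mul, htot, hpow, hpow, mul_assoc, ← Real.rpow_add hq0]
        have : (q : ℝ) ^ ((3 * (k : ℝ) - d) / 2 + k / 2)
            = (q : ℝ) ^ k * (q : ℝ) ^ k / (q : ℝ) ^ ((d : ℝ) / 2) := by
          rw [← Real.rpow_natCast, ← Real.rpow_add hq0, ← Real.rpow_sub hq0]
          congr 1; ring
        rw [this]; ring

end Comparison

/-! ### Convergence to the Gaussian moments -/

section GaussianMoments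

/-- The `k`-th moment of the standard Gaussian law. -/
noncomputable def gaussianMoment (k : ℕ) : ℝ := ∫ x, x ^ k ∂(gaussianReal 0 1)

theorem integrable_pow_gaussianReal (k : ℕ) :
    Integrable (fun x : ℝ => x ^ k) (gaussianReal 0 1) := by
  refine integrable_pow_of_mem_interior_integrableExpSet (X := fun x => x) ?_ k
  rw [integrableExpSet_fun_id_gaussianReal]; simp

theorem gaussianMoment_zero : gaussianMoment 0 = 1 := by simp [gaussianMoment]

theorem gaussianMoment_one : gaussianMoment 1 = 0 := by simp [gaussianMoment]

/-- Integration by parts against the density. -/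
theorem gaussianMoment_add_two (k : ℕ) :
    gaussianMoment (k + 2) = (k + 1) * gaussianMoment k := by
  have hpdf : ∀ x, gaussianPDFReal 0 1 x = (√(2 * Real.pi))⁻¹ * Real.exp (-x ^ 2 / 2) := by
    intro x; simp [gaussianPDFReal]
  have hI : ∀ n : ℕ, Integrable (fun x : ℝ => gaussianPDFReal 0 1 x * x ^ n) := by
    intro n
    have := integrable_pow_gaussianReal n
    rw [gaussianReal_of_var_ne_zero _ one_ne_zero,
      integrable_withDensity_iff_integrable_smul' (by fun_prop) (by simp [gaussianPDF])] at this
    simpa [gaussianPDF, ENNReal.toReal_ofReal (gaussianPDFReal_nonneg _ _ _)] using this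
  have hd : ∀ x : ℝ, HasDerivAt (fun x => gaussianPDFReal 0 1 x * x ^ (k + 1))
      ((k + 1) * (gaussianPDFReal 0 1 x * x ^ k) - gaussianPDFReal 0 1 x * x ^ (k + 2)) x := by
    intro x
    have h1 : HasDerivAt (fun x : ℝ => Real.exp (-x ^ 2 / 2)) (Real.exp (-x ^ 2 / 2) * (-x)) x := by
      have h : HasDerivAt (fun x : ℝ => -x ^ 2 / 2) (-x) x := by
        have := ((hasDerivAt_pow 2 x).neg).div_const 2
        refine this.congr_deriv ?_
        simp; ring
      exact h.exp
    have h2 := (h1.const_mul (√(2 * Real.pi))⁻¹).mul (hasDerivAt_pow (k + 1) x)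
    rw [show gaussianPDFReal 0 1 = _ from funext hpdf]
    refine h2.congr_deriv ?_
    push_cast
    ring
  have h0 := integral_eq_zero_of_hasDerivAt_of_integrable hd
    (((hI k).const_mul _).sub (hI (k + 2))) (hI (k + 1))
  rw [integral_sub ((hI k).const_mul _) (hI (k + 2)), integral_const_mul] at h0
  simp only [gaussianMoment, integral_gaussianReal_eq_integral_smul one_ne_zero, smul_eq_mul]
  linarith

/-- The normalised power sums of the trinomial law converge to Gaussian moments, even when a fixed
number `s` of the `q` summands is left out. The coefficients of `φ ^ n` are linked by
`(φ ^ (n + 1))' = (n + 1) φ ^ n φ'`, which in the limit becomes the recursion of the Gaussian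
moments. -/
theorem tendsto_coeff_trinomialSeries_pow (k : ℕ) : ∀ s : ℕ,
    Tendsto (fun q : ℕ => (trinomialSeries q ^ (q - s)).coeff k / √(q : ℝ) ^ k) atTop
      (𝓝 (gaussianMoment k / k.factorial)) := by
  induction k using Nat.strong_induction_on with
  | _ k ih =>
  intro s
  cases k with
  | zero =>
    simp [gaussianMoment_zero, trinomialSeries, trinomialMoment]
  | succ k =>
    -- the contribution of the `i`-th coefficient of `φ'`
    let w : ℕ → ℕ → ℝ := fun i q =>
      trinomialMoment q (i + 1) / i.factorial * (√(q : ℝ) / √(q : ℝ) ^ i)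
    have hsq : Tendsto (fun q : ℕ => √(q : ℝ)) atTop atTop :=
      Real.tendsto_sqrt_atTop.comp tendsto_natCast_atTop_atTop
    have hw : ∀ i, Tendsto (w i) atTop (𝓝 (if i = 1 then 1 else 0)) := by
      intro i
      rcases i with _ | _ | i
      · simp [w, trinomialMoment]
      · have h1 : Tendsto (fun q : ℕ => (q : ℝ) / (q + 1)) atTop (𝓝 1) :=
          tendsto_natCast_div_add_atTop 1
        simp only [zero_add, if_true]
        refine h1.congr' ?_
        filter_upwards [eventually_gt_atTop 0] with q hq
        have : √(q : ℝ) ≠ 0 := (Real.sqrt_pos.2 (by exact_mod_cast hq)).ne'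
        simp [w, trinomialMoment, this, even_two]
      · have hz : Tendsto (fun q : ℕ => 1 / √(q : ℝ)) atTop (𝓝 0) := by
          simp only [one_div]
          exact hsq.inv_tendsto_atTop
        simp only [Nat.add_eq_right, Nat.add_eq_zero_iff, one_ne_zero, and_false, if_false]
        refine squeeze_zero' (Eventually.of_forall fun q => ?_) ?_ hz
        · have := trinomialMoment_nonneg q (i + 1 + 1 + 1)
          positivity
        · filter_upwards [eventually_gt_atTop 0] with q hq
          have hq1 : 1 ≤ √(q : ℝ) := Real.one_le_sqrt.2 (by exact_mod_cast hq)
          have h1 : trinomialMoment q (i + 1 + 1 + 1) / (i + 1 + 1).factorial ≤ 1 :=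
            div_le_one_of_le₀ ((trinomialMoment_le_one _ _).trans
              (by exact_mod_cast Nat.one_le_iff_ne_zero.2 (Nat.factorial_ne_zero _)))
              (by positivity)
          have h2 : √(q : ℝ) / √(q : ℝ) ^ (i + 1 + 1) ≤ 1 / √(q : ℝ) := by
            rw [div_le_div_iff₀ (by positivity) (by positivity), pow_succ, pow_succ]
            nlinarith [one_le_pow₀ hq1 (n := i),
              mul_pos (by linarith : 0 < √(q : ℝ)) (by linarith : 0 < √(q : ℝ))]
          calc w (i + 1 + 1) q ≤ 1 * (1 / √(q : ℝ)) := by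
                apply mul_le_mul h1 h2 (by positivity) zero_le_one
            _ = _ := one_mul _
    have hrec : ∀ᶠ q : ℕ in atTop,
        ((q - s : ℕ) : ℝ) / q / (k + 1) * ∑ p ∈ antidiagonal k, w p.1 q *
            ((trinomialSeries q ^ (q - (s + 1))).coeff p.2 / √(q : ℝ) ^ p.2)
          = (trinomialSeries q ^ (q - s)).coeff (k + 1) / √(q : ℝ) ^ (k + 1) := by
      filter_upwards [eventually_gt_atTop s] with q hq
      have hq0 : (0 : ℝ) < q := by exact_mod_cast (Nat.zero_le s).trans_lt hq
      have hr : 0 < √(q : ℝ) := Real.sqrt_pos.2 hq0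
      obtain ⟨n, hn⟩ : ∃ n, q - s = n + 1 := ⟨q - s - 1, by omega⟩
      have hn' : q - (s + 1) = n := by omega
      have hder := congrArg (PowerSeries.coeff k)
        (PowerSeries.derivative_pow (trinomialSeries q) (n + 1))
      rw [PowerSeries.coeff_derivative, Nat.add_sub_cancel, mul_assoc, ← nsmul_eq_mul, map_nsmul,
        nsmul_eq_mul, mul_comm (trinomialSeries q ^ n), PowerSeries.coeff_mul] at hder
      have hterm : ∀ p ∈ antidiagonal k,
          w p.1 q * ((trinomialSeries q ^ n).coeff p.2 / √(q : ℝ) ^ p.2)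
            = (PowerSeries.derivative (R := ℝ) (trinomialSeries q)).coeff p.1
              * (trinomialSeries q ^ n).coeff p.2 * (√(q : ℝ) / √(q : ℝ) ^ k) := by
        intro p hp
        rw [PowerSeries.coeff_derivative, trinomialSeries, PowerSeries.coeff_mk,
          ← HasAntidiagonal.mem_antidiagonal.1 hp, pow_add, Nat.factorial_succ]
        simp only [w]
        push_cast
        field_simp
      rw [hn', hn, sum_congr rfl hterm, ← sum_mul]
      have hk : ((k : ℝ) + 1) ≠ 0 := by positivity
      rw [← eq_div_iff hk] at hder
      rw [hder]
      have hqq : (q : ℝ) = √(q : ℝ) * √(q : ℝ) := (Real.mul_self_sqrt hq0.le).symm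
      have hcancel : √(q : ℝ) / √(q : ℝ) ^ k / q = 1 / √(q : ℝ) ^ (k + 1) := by
        rw [pow_succ]
        nth_rewrite 3 [hqq]
        field_simp
      calc _ = ((n + 1 : ℕ) : ℝ) / (k + 1) * (∑ p ∈ antidiagonal k,
              (PowerSeries.derivative (R := ℝ) (trinomialSeries q)).coeff p.1
                * (trinomialSeries q ^ n).coeff p.2) * (√(q : ℝ) / √(q : ℝ) ^ k / q) := by ring
        _ = _ := by rw [hcancel]; ring
    have hfrac : Tendsto (fun q : ℕ => ((q - s : ℕ) : ℝ) / q) atTop (𝓝 1) := by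
      have h1 : Tendsto (fun q : ℕ => 1 - (s : ℝ) / q) atTop (𝓝 (1 - 0)) :=
        tendsto_const_nhds.sub (tendsto_const_div_atTop_nhds_zero_nat _)
      rw [sub_zero] at h1
      refine h1.congr' ?_
      filter_upwards [eventually_gt_atTop s] with q hq
      have hq0 : (q : ℝ) ≠ 0 := by exact_mod_cast ((Nat.zero_le s).trans_lt hq).ne'
      rw [Nat.cast_sub hq.le]
      field_simp
    have hsum := tendsto_finsetSum (antidiagonal k) fun p hp => (hw p.1).mul
      (ih p.2 (Nat.lt_succ_iff.2 (HasAntidiagonal.mem_antidiagonal.1 hp ▸ Nat.le_add_left _ _))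
        (s + 1))
    have hlim := ((hfrac.div_const ((k : ℝ) + 1)).mul hsum).congr' hrec
    convert hlim using 2
    -- only the term `i = 1` survives in the limit
    cases k with
    | zero => simp [gaussianMoment_one]
    | succ k =>
      rw [sum_eq_single (1, k)]
      · rw [gaussianMoment_add_two, Nat.factorial_succ, Nat.factorial_succ]
        push_cast
        simp only [one_mul]
        field_simp
      · rintro ⟨i, j⟩ hp hne
        have : i ≠ 1 := by
          rintro rfl
          have := HasAntidiagonal.mem_antidiagonal.1 hp
          exact hne (by simp; omega)
        simp [this]
      · intro h
        exact absurd (HasAntidiagonal.mem_antidiagonal.2 (add_comm 1 k)) h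

theorem tendsto_trinomialSumMoment (k : ℕ) :
    Tendsto (fun q => trinomialSumMoment q k) atTop (𝓝 (gaussianMoment k)) := by
  have h := (tendsto_coeff_trinomialSeries_pow k 0).const_mul (k.factorial : ℝ)
  have hk : (k.factorial : ℝ) ≠ 0 := by positivity
  rw [mul_div_cancel₀ _ hk] at h
  simpa [trinomialSumMoment, mul_div_assoc] using h

end GaussianMoments

end

/-! ### The method of moments -/

section MethodOfMoments

/-- The Taylor polynomial of `y ↦ exp (i y)` with its first `n` terms, that is, of degree
`n - 1`. -/
noncomputable def expITaylor (n : ℕ) (y : ℝ) : ℂ :=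
  ∑ k ∈ Finset.range n, (y * Complex.I) ^ k / k.factorial

theorem hasDerivAt_expITaylor_succ (n : ℕ) (y : ℝ) :
    HasDerivAt (expITaylor (n + 1)) (Complex.I * expITaylor n y) y := by
  have h1 : HasDerivAt (fun y : ℝ => (y : ℂ) * Complex.I) Complex.I y := by
    simpa using (Complex.ofRealCLM.hasDerivAt (x := y)).mul_const Complex.I
  induction n with
  | zero =>
    have : expITaylor (0 + 1) = fun _ => 1 := by ext y; simp [expITaylor]
    rw [this]
    simpa [expITaylor] using hasDerivAt_const y (1 : ℂ)
  | succ n ih =>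
    have h2 := ih.add ((h1.pow (n + 1)).div_const ((n + 1).factorial : ℂ))
    have h3 : expITaylor (n + 1 + 1)
        = expITaylor (n + 1) + fun y : ℝ =>
          ((y : ℂ) * Complex.I) ^ (n + 1) / (n + 1).factorial := by
      ext y; exact Finset.sum_range_succ _ _
    rw [h3]
    refine h2.congr_deriv ?_
    have hn : ((n : ℂ) + 1) ≠ 0 := Nat.cast_add_one_ne_zero n
    have hf : ((n.factorial : ℕ) : ℂ) ≠ 0 := Nat.cast_ne_zero.2 (Nat.factorial_ne_zero n)
    rw [show expITaylor (n + 1) y = expITaylor n y + _ from Finset.sum_range_succ _ _,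
      Nat.factorial_succ]
    push_cast
    field_simp

theorem norm_exp_sub_expITaylor_le_of_nonneg (n : ℕ) : ∀ y : ℝ, 0 ≤ y →
    ‖Complex.exp (y * Complex.I) - expITaylor n y‖ ≤ y ^ n / n.factorial := by
  induction n with
  | zero => intro y _; simp [expITaylor, Complex.norm_exp_ofReal_mul_I]
  | succ n ih =>
    intro y hy
    have hd : ∀ x : ℝ, HasDerivAt (fun y : ℝ => Complex.exp (y * Complex.I) - expITaylor (n + 1) y)
        (Complex.I * (Complex.exp (x * Complex.I) - expITaylor n x)) x := by
      intro x
      have h1 : HasDerivAt (fun y : ℝ => (y : ℂ) * Complex.I) Complex.I x := by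
        simpa using (Complex.ofRealCLM.hasDerivAt (x := x)).mul_const Complex.I
      refine (h1.cexp.sub (hasDerivAt_expITaylor_succ n x)).congr_deriv ?_
      ring
    have hB : ∀ x : ℝ, HasDerivAt (fun y : ℝ => y ^ (n + 1) / (n + 1).factorial)
        (x ^ n / n.factorial) x := by
      intro x
      refine ((hasDerivAt_pow (n + 1) x).div_const _).congr_deriv ?_
      rw [Nat.factorial_succ]
      push_cast
      field_simp
    refine image_norm_le_of_norm_deriv_right_le_deriv_boundary (a := 0) (b := y)
      (fun x _ => (hd x).continuousAt.continuousWithinAt) (fun x _ => (hd x).hasDerivWithinAt)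
      ?_ hB (fun x hx => ?_) ⟨hy, le_rfl⟩
    · simp [expITaylor, Finset.sum_range_succ']
    · rw [norm_mul, Complex.norm_I, one_mul]
      exact ih x hx.1

theorem norm_exp_sub_expITaylor_le (n : ℕ) (y : ℝ) :
    ‖Complex.exp (y * Complex.I) - expITaylor n y‖ ≤ |y| ^ n / n.factorial := by
  rcases le_total 0 y with h | h
  · rw [abs_of_nonneg h]
    exact norm_exp_sub_expITaylor_le_of_nonneg n y h
  · have h1 := norm_exp_sub_expITaylor_le_of_nonneg n (-y) (neg_nonneg.2 h)
    rw [abs_of_nonpos h]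
    refine le_trans (le_of_eq ?_) h1
    rw [← Complex.norm_conj, map_sub, ← Complex.exp_conj, expITaylor, expITaylor, map_sum]
    simp

/-- The characteristic function is approximated by its Taylor polynomial, whose coefficients are
moments. The even order `2 n` makes the remainder an even moment, free of absolute values. -/
theorem norm_charFun_sub_le (μ : Measure ℝ) [IsProbabilityMeasure μ]
    (hμ : ∀ k : ℕ, Integrable (fun x => x ^ k) μ) (t : ℝ) (n : ℕ) :
    ‖charFun μ t - ∑ k ∈ Finset.range (2 * n),
        (t * Complex.I) ^ k / k.factorial * ((∫ x, x ^ k ∂μ : ℝ) : ℂ)‖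
      ≤ t ^ (2 * n) / (2 * n).factorial * ∫ x, x ^ (2 * n) ∂μ := by
  have hterm : ∀ k : ℕ, Integrable
      (fun x : ℝ => (t * Complex.I) ^ k / k.factorial * ((x ^ k : ℝ) : ℂ)) μ :=
    fun k => (hμ k).ofReal.const_mul _
  have hT : ∀ x : ℝ, expITaylor (2 * n) (t * x)
      = ∑ k ∈ Finset.range (2 * n), (t * Complex.I) ^ k / k.factorial * ((x ^ k : ℝ) : ℂ) := by
    intro x
    refine Finset.sum_congr rfl fun k _ => ?_
    push_cast; ring
  have hexp : Integrable (fun x : ℝ => Complex.exp (t * x * Complex.I)) μ := by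
    refine Integrable.of_bound (C := 1) (by fun_prop) (Eventually.of_forall fun x => ?_)
    rw [← Complex.ofReal_mul, Complex.norm_exp_ofReal_mul_I]
  have hsum : ∑ k ∈ Finset.range (2 * n),
        (t * Complex.I) ^ k / k.factorial * ((∫ x, x ^ k ∂μ : ℝ) : ℂ)
      = ∫ x, expITaylor (2 * n) (t * x) ∂μ := by
    simp_rw [hT]
    rw [integral_finsetSum _ fun k _ => hterm k]
    refine Finset.sum_congr rfl fun k _ => ?_
    rw [integral_const_mul, integral_complex_ofReal]
  have hTi : Integrable (fun x : ℝ => expITaylor (2 * n) (t * x)) μ := by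
    simp_rw [hT]
    exact integrable_finsetSum _ fun k _ => hterm k
  rw [charFun_apply_real, hsum, ← integral_sub hexp hTi, ← integral_const_mul]
  refine norm_integral_le_of_norm_le ((hμ _).const_mul _) (Eventually.of_forall fun x => ?_)
  have := norm_exp_sub_expITaylor_le (2 * n) (t * x)
  rw [(even_two_mul n).pow_abs, mul_pow] at this
  push_cast at this
  refine this.trans (le_of_eq (by ring))

/-- The method of moments: if the moments of a sequence of laws converge to those of a law whose
even moments are small compared to factorials, then the laws converge weakly. -/
theorem tendsto_of_tendsto_moments {μ : ℕ → ProbabilityMeasure ℝ} {ν : ProbabilityMeasure ℝ}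
    (hμ : ∀ i (k : ℕ), Integrable (fun x => x ^ k) (μ i : Measure ℝ))
    (hν : ∀ k : ℕ, Integrable (fun x => x ^ k) (ν : Measure ℝ))
    (hgrowth : ∀ t : ℝ, Tendsto (fun n : ℕ =>
      t ^ (2 * n) / (2 * n).factorial * ∫ x, x ^ (2 * n) ∂(ν : Measure ℝ)) atTop (𝓝 0))
    (h : ∀ k : ℕ, Tendsto (fun i => ∫ x, x ^ k ∂(μ i : Measure ℝ)) atTop
      (𝓝 (∫ x, x ^ k ∂(ν : Measure ℝ)))) :
    Tendsto μ atTop (𝓝 ν) := by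
  refine ProbabilityMeasure.tendsto_of_tendsto_charFun fun t => ?_
  rw [Metric.tendsto_atTop']
  intro ε hε
  obtain ⟨n, hn⟩ := ((hgrowth t).eventually (gt_mem_nhds (by positivity : (0 : ℝ) < ε / 4))).exists
  have h1 : Tendsto (fun i => ∑ k ∈ Finset.range (2 * n),
        (t * Complex.I) ^ k / k.factorial * ((∫ x, x ^ k ∂(μ i : Measure ℝ) : ℝ) : ℂ)) atTop
      (𝓝 (∑ k ∈ Finset.range (2 * n),
        (t * Complex.I) ^ k / k.factorial * ((∫ x, x ^ k ∂(ν : Measure ℝ) : ℝ) : ℂ))) :=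
    tendsto_finsetSum _ fun k _ =>
      ((Complex.continuous_ofReal.tendsto _).comp (h k)).const_mul _
  have h2 := ((h (2 * n)).const_mul (t ^ (2 * n) / (2 * n).factorial)).eventually (gt_mem_nhds hn)
  have h3 := h1.eventually (Metric.ball_mem_nhds _ (by positivity : (0 : ℝ) < ε / 4))
  obtain ⟨N, hN⟩ := eventually_atTop.1 (h2.and h3)
  refine ⟨N, fun i hi => ?_⟩
  obtain ⟨h2, h3⟩ := hN i hi.le
  have a1 := norm_charFun_sub_le (μ i) (hμ i) t n
  have a2 := norm_charFun_sub_le ν hν t n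
  rw [← dist_eq_norm] at a1 a2
  have a3 := dist_triangle4_right (charFun (μ i : Measure ℝ) t) (charFun (ν : Measure ℝ) t)
    (∑ k ∈ Finset.range (2 * n),
        (t * Complex.I) ^ k / k.factorial * ((∫ x, x ^ k ∂(μ i : Measure ℝ) : ℝ) : ℂ))
    (∑ k ∈ Finset.range (2 * n),
        (t * Complex.I) ^ k / k.factorial * ((∫ x, x ^ k ∂(ν : Measure ℝ) : ℝ) : ℂ))
  linarith

theorem gaussianMoment_two_mul (n : ℕ) :
    gaussianMoment (2 * n) / (2 * n).factorial = (1 / 2) ^ n / n.factorial := by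
  induction n with
  | zero => simp [gaussianMoment_zero]
  | succ n ih =>
    have hf : ((2 * n).factorial : ℝ) ≠ 0 := by positivity
    rw [div_eq_iff hf] at ih
    rw [show 2 * (n + 1) = 2 * n + 2 by ring, gaussianMoment_add_two, ih, Nat.factorial_succ,
      Nat.factorial_succ, Nat.factorial_succ]
    push_cast
    field_simp
    ring

theorem tendsto_gaussianMoment_growth (t : ℝ) : Tendsto (fun n : ℕ =>
    t ^ (2 * n) / (2 * n).factorial * ∫ x, x ^ (2 * n) ∂(gaussianReal 0 1)) atTop (𝓝 0) := by
  refine (FloorSemiring.tendsto_pow_div_factorial_atTop (t ^ 2 / 2)).congr fun n => ?_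
  have := gaussianMoment_two_mul n
  rw [gaussianMoment] at this
  rw [div_mul_eq_mul_div, mul_div_assoc, this, pow_mul, div_pow, div_pow, one_pow]
  ring

end MethodOfMoments

/-! ### The value distribution -/

section ValueLaw

variable {K : Type*} [Field K] [Fintype K]

theorem valueLaw_eq_sum (d : ℕ) : (valueLaw K d : Measure ℝ)
    = ∑ F ∈ family K d, ((family K d).card : ENNReal)⁻¹ • Measure.dirac (normSum F) := by
  classical
  ext s hs
  change ((PMF.uniformOfFinset (family K d) (family_nonempty K d)).map normSum).toMeasure s = _
  rw [PMF.toMeasure_apply_eq_toOuterMeasure_apply _ hs, PMF.toOuterMeasure_map_apply,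
    PMF.toOuterMeasure_uniformOfFinset_apply, Measure.coe_finsetSum, Finset.sum_apply]
  simp only [Measure.smul_apply, Measure.dirac_apply' _ hs, smul_eq_mul]
  rw [← Finset.mul_sum, ENNReal.div_eq_inv_mul]
  simp [Set.indicator_apply]

theorem integrable_valueLaw (d : ℕ) (f : ℝ → ℝ) : Integrable f (valueLaw K d : Measure ℝ) := by
  rw [valueLaw_eq_sum]
  refine integrable_finsetSum_measure.2 fun F _ => ?_
  refine (integrable_dirac (by simp)).smul_measure ?_
  simpa using (family_nonempty K d).ne_empty

theorem integral_pow_valueLaw (k d : ℕ) :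
    ∫ x, x ^ k ∂(valueLaw K d : Measure ℝ) = moment K k d := by
  have hint := integrable_valueLaw (K := K) d (fun x => x ^ k)
  rw [valueLaw_eq_sum] at hint ⊢
  rw [integral_finsetSum_measure (integrable_finsetSum_measure.1 hint), moment, Finset.mul_sum]
  simp [integral_smul_measure]

end ValueLaw

/-! ### The joint limit -/

section Limit

theorem tendsto_moment {ι : Type*} {l : Filter ι} {K : ι → Type*} [∀ i, Field (K i)]
    [∀ i, Fintype (K i)] {d : ι → ℕ} (hodd : ∀ i, Odd (Fintype.card (K i)))
    (hq : Tendsto (fun i => Fintype.card (K i)) l atTop) (hd : Tendsto d l atTop) (k : ℕ) :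
    Tendsto (fun i => moment (K i) k (d i)) l (𝓝 (∫ x, x ^ k ∂(gaussianReal 0 1))) := by
  have h1 : Tendsto (fun i => trinomialSumMoment (Fintype.card (K i)) k) l
      (𝓝 (gaussianMoment k)) := (tendsto_trinomialSumMoment k).comp hq
  have h2 : Tendsto (fun i => moment (K i) k (d i) - trinomialSumMoment (Fintype.card (K i)) k) l
      (𝓝 0) := by
    -- once `d ≥ 3 k + 2` the error term is at most `6 / q`
    have hinv : Tendsto (fun i => 6 * ((Fintype.card (K i) : ℝ))⁻¹) l (𝓝 0) := by
      simpa using ((tendsto_inv_atTop_zero.comp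
        (tendsto_natCast_atTop_atTop (R := ℝ))).comp hq).const_mul 6
    refine squeeze_zero_norm' ?_ hinv
    filter_upwards [hd.eventually_ge_atTop (3 * k + 2)] with i hi
    refine (abs_moment_sub_le (hodd i) k (d i)).trans ?_
    have hq1 : (1 : ℝ) ≤ Fintype.card (K i) := by exact_mod_cast Fintype.card_pos
    have hi' : 3 * (k : ℝ) + 2 ≤ d i := by exact_mod_cast hi
    rw [← Real.rpow_neg_one]
    gcongr
    linarith
  simpa [gaussianMoment] using h2.add h1

/-- The neighbourhoods of the Gaussian law are reached uniformly over all fields that are large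
enough; this reduces convergence along an arbitrary filter to sequences. -/
theorem exists_forall_valueLaw_mem {U : Set (ProbabilityMeasure ℝ)} (hU : U ∈ 𝓝 stdGaussian) :
    ∃ N : ℕ, ∀ (K : Type*) [Field K] [Fintype K], Odd (Fintype.card K) → N ≤ Fintype.card K →
      ∀ d, N ≤ d → valueLaw K d ∈ U := by
  -- a sequence of counterexamples would contradict the sequential limit
  by_contra hcon
  push Not at hcon
  choose K hF hT hodd hq d hd hmem using hcon
  have hlim : Tendsto (fun n => valueLaw (K n) (d n)) atTop (𝓝 stdGaussian) := by
    refine tendsto_of_tendsto_moments (fun i k => integrable_valueLaw _ _)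
      integrable_pow_gaussianReal tendsto_gaussianMoment_growth fun k => ?_
    simp_rw [integral_pow_valueLaw]
    exact tendsto_moment hodd (tendsto_atTop_mono hq tendsto_id)
      (tendsto_atTop_mono hd tendsto_id) k
  obtain ⟨n, hn⟩ := (hlim.eventually_mem hU).exists
  exact hmem n hn

end Limit

end CharSum

theorem theorem2 :
    -- the moment comparison, with one absolute implied constant
    (∃ C : ℝ, ∀ (K : Type*) [Field K] [Fintype K], Odd (Fintype.card K) → ∀ k d : ℕ,
      ∀ (Ω : Type*) [MeasurableSpace Ω] (P : Measure Ω) [IsProbabilityMeasure P]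
        (Y : Fin (Fintype.card K) → Ω → ℝ),
        iIndepFun Y P → (∀ i, HasLaw (Y i) (CharSum.trinomialLaw (Fintype.card K)) P) →
        |CharSum.moment K k d - ∫ ω, ((∑ i, Y i ω) / √(Fintype.card K : ℝ)) ^ k ∂P|
          ≤ C * (Fintype.card K : ℝ) ^ ((3 * (k : ℝ) - (d : ℝ)) / 2)) ∧
    -- the joint limit, along any family of odd finite fields and degrees with `q, d → ∞`
    (∀ (ι : Type*) (l : Filter ι) (K : ι → Type*) [∀ i, Field (K i)] [∀ i, Fintype (K i)]
      (d : ι → ℕ), (∀ i, Odd (Fintype.card (K i))) →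
      Tendsto (fun i => Fintype.card (K i)) l atTop → Tendsto d l atTop →
        (∀ k : ℕ, Tendsto (fun i => CharSum.moment (K i) k (d i)) l
          (𝓝 (∫ x, x ^ k ∂(gaussianReal 0 1)))) ∧
        Tendsto (fun i => CharSum.valueLaw (K i) (d i)) l (𝓝 CharSum.stdGaussian)) := by
  refine ⟨⟨6, fun K _ _ hodd k d Ω _ P _ Y hY hlaw => ?_⟩,
    fun ι l K _ _ d hodd hq hd => ⟨fun k => CharSum.tendsto_moment hodd hq hd k, ?_⟩⟩
  · rw [CharSum.integral_sum_pow P Fintype.card_pos (Fintype.card_fin _) Y hY hlaw]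
    exact CharSum.abs_moment_sub_le hodd k d
  · refine tendsto_def.2 fun U hU => ?_
    obtain ⟨N, hN⟩ := CharSum.exists_forall_valueLaw_mem hU
    filter_upwards [hq.eventually_ge_atTop N, hd.eventually_ge_atTop N] with i h1 h2
    exact hN (K i) (hodd i) h1 (d i) h2
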